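/- Let $A$ be a commutative ring and let $q$ be a positive integer that is invertible in $A$. **Notation.** $W_0(A)$ is the quotient of the Grothendieck ring $K_0(\underline{\mathrm{End}}_A)$ of pairs $(E,f)$, with $E$ a finitely generated projective $A$-module and $f\in\mathrm{End}_A(E)$ (relations $[E,f]=[E',f']+[E'',f'']$ for all short exact sequences of pairs, product induced by $\otimes_A$), by the ideal generated by the pairs $(E,0)$. For such a pair, $\det(1-tM(f))\in A[t]$ is the determinant of $1-tM$ with $M$ the matrix of $f\oplus 0$ on $E\oplus E'\cong A^n$, for any complement $E'$ (it does not depend on the choices). $\Lambda^q(A)$ is the set $1+tA[[t]]$ with the usual product of power series as addition and with the product $\star_q$ that is the biadditive, continuous and functorial extension of $(1-at)^{-q}\star_q(1-bt)^{-q}=(1-abt)^{-q}$, so that explicitly $$\prod_{m\ge1}(1-a_mt^m)^{-q}\star_q\prod_{n\ge1}(1-b_nt^n)^{-q}=\prod_{m,n\ge1}\bigl(1-a_m^{n/d}b_n^{m/d}t^{\mathrm{lcm}(m,n)}\bigr)^{-qd},\qquad d=\gcd(m,n);$$ it is a commutative ring with unit $(1-t)^{-q}$. $W^q(A)$ is the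 set of sequences $(x_n)_{n\ge1}$ in $A$ with the ring operations, functorial in $A$ under the componentwise action of ring homomorphisms, for which $\Phi^q\colon(x_n)_n\mapsto\bigl(\sum_{d\mid n}d\,q^{n/d-1}x_d^{n/d}\bigr)_n$ is a ring homomorphism to the product ring $A^{\{1,2,\dots\}}$ for every commutative ring. **Statement.** The assignment $L^q(E,f)=\det(1-tM(f))^{-q}$ determines an injective homomorphism of rings $$L^q\colon W_0(A)\to\Lambda^q(A),$$ whose image is $$\left\{\frac{(1+a_1t+\dots+a_nt^n)^q}{(1+b_1t+\dots+b_mt^m)^q}\;:\;n,m\ge0,\ a_i,b_j\in A\right\}.$$ Moreover $W^q(A)$ contains an isomorphic copy of $W_0(A)$: there is an injective homomorphism of rings $\varphi\colon W_0(A)\to W^q(A)$, which sends $1$ to a multiplicative identity of $W^q(A)$, such that $L^q$ is the composite of $\varphi$ with the $q$-Artin--Hasse map $W^q(A)\to\Lambda^q(A)$, $(x_n)_n\mapsto\prod_{n\ge1}(1-q\,x_nt^n)^{-1}$. -/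

import Mathlib

open scoped TensorProduct PowerSeries Polynomial

universe u

namespace WittQ

/-! ### The Grothendieck ring of endomorphisms and `W₀(A)` -/

section WZero

/-- An object `(E, f)` of the category of endomorphisms over `A`: a finitely generated
projective `A`-module `E` together with an `A`-linear endomorphism `f` of `E`. -/
structure EndObj (A : Type u) [CommRing A] where
  carrier : Type u
  [addCommGroup : AddCommGroup carrier]
  [module : Module A carrier]
  [finite : Module.Finite A carrier]
  [projective : Module.Projective A carrier]
  f : carrier →ₗ[A] carrier

attribute [instance] EndObj.addCommGroup EndObj.module EndObj.finite EndObj.projective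

variable {A : Type u} [CommRing A]

namespace EndObj

/-- Isomorphism of pairs: a linear isomorphism commuting with the endomorphisms. -/
def Iso (E F : EndObj A) : Prop :=
  ∃ e : E.carrier ≃ₗ[A] F.carrier, ∀ x, e (E.f x) = F.f (e x)

theorem Iso.refl (E : EndObj A) : Iso E E := ⟨LinearEquiv.refl A _, fun _ => rfl⟩

theorem Iso.symm {E F : EndObj A} (h : Iso E F) : Iso F E := by
  obtain ⟨e, he⟩ := h
  refine ⟨e.symm, fun x => ?_⟩
  apply e.injective
  rw [he]; simp

theorem Iso.trans {E F G : EndObj A} (h : Iso E F) (k : Iso F G) : Iso E G := by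
  obtain ⟨e, he⟩ := h
  obtain ⟨d, hd⟩ := k
  exact ⟨e.trans d, fun x => by simp [he, hd]⟩

instance setoid (A : Type u) [CommRing A] : Setoid (EndObj A) :=
  ⟨Iso, Iso.refl, Iso.symm, Iso.trans⟩

/-- The tensor product `(E ⊗ F, f ⊗ g)`. -/
noncomputable def tensor (E F : EndObj A) : EndObj A where
  carrier := E.carrier ⊗[A] F.carrier
  f := TensorProduct.map E.f F.f

/-- The pair `(A, id)`. -/
def unit (A : Type u) [CommRing A] : EndObj A where
  carrier := A
  f := LinearMap.id

/-- A short exact sequence `0 → (E', f') → (E, f) → (E'', f'') → 0`. -/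
def ShortExact (E' E E'' : EndObj A) : Prop :=
  ∃ (i : E'.carrier →ₗ[A] E.carrier) (p : E.carrier →ₗ[A] E''.carrier),
    Function.Injective i ∧ Function.Exact i p ∧ Function.Surjective p ∧
      (∀ x, i (E'.f x) = E.f (i x)) ∧ ∀ x, p (E.f x) = E''.f (p x)

end EndObj

/-- Isomorphism classes of pairs `(E, f)`. -/
def EndClass (A : Type u) [CommRing A] : Type (u + 1) := Quotient (EndObj.setoid A)

/-- The isomorphism classes form a commutative monoid under the tensor product. -/
noncomputable instance : CommMonoid (EndClass A) where
  mul := Quotient.map₂ EndObj.tensor (by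
    rintro E E' ⟨e, he⟩ F F' ⟨d, hd⟩
    refine ⟨TensorProduct.congr e d, fun x => ?_⟩
    exact LinearMap.congr_fun (f := (TensorProduct.congr e d).toLinearMap ∘ₗ
      TensorProduct.map E.f F.f) (g := TensorProduct.map E'.f F'.f ∘ₗ
      (TensorProduct.congr e d).toLinearMap)
      (TensorProduct.ext' fun x y => by simp [he, hd]) x)
  one := Quotient.mk _ (EndObj.unit A)
  mul_assoc := by
    rintro ⟨E⟩ ⟨F⟩ ⟨G⟩
    refine Quotient.sound ⟨TensorProduct.assoc A E.carrier F.carrier G.carrier, fun x => ?_⟩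
    exact LinearMap.congr_fun (f := (TensorProduct.assoc A _ _ _).toLinearMap ∘ₗ
      TensorProduct.map (TensorProduct.map E.f F.f) G.f) (g := TensorProduct.map E.f
      (TensorProduct.map F.f G.f) ∘ₗ (TensorProduct.assoc A _ _ _).toLinearMap)
      (TensorProduct.ext_threefold fun _ _ _ => rfl) x
  one_mul := by
    rintro ⟨E⟩
    refine Quotient.sound ⟨TensorProduct.lid A E.carrier, fun x => ?_⟩
    exact LinearMap.congr_fun (f := (TensorProduct.lid A _).toLinearMap ∘ₗ
      TensorProduct.map LinearMap.id E.f) (g := E.f ∘ₗ (TensorProduct.lid A _).toLinearMap)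
      (TensorProduct.ext' fun a y => by simp) x
  mul_one := by
    rintro ⟨E⟩
    refine Quotient.sound ⟨TensorProduct.rid A E.carrier, fun x => ?_⟩
    exact LinearMap.congr_fun (f := (TensorProduct.rid A _).toLinearMap ∘ₗ
      TensorProduct.map E.f LinearMap.id) (g := E.f ∘ₗ (TensorProduct.rid A _).toLinearMap)
      (TensorProduct.ext' fun a y => by simp) x
  mul_comm := by
    rintro ⟨E⟩ ⟨F⟩
    refine Quotient.sound ⟨TensorProduct.comm A E.carrier F.carrier, fun x => ?_⟩
    exact LinearMap.congr_fun (f := (TensorProduct.comm A _ _).toLinearMap ∘ₗ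
      TensorProduct.map E.f F.f) (g := TensorProduct.map F.f E.f ∘ₗ
      (TensorProduct.comm A _ _).toLinearMap) (TensorProduct.ext' fun a y => by simp) x

/-- The class of `(E, f)` in the free abelian group on isomorphism classes. -/
noncomputable def freeClass (E : EndObj A) : FreeAbelianGroup (EndClass A) :=
  FreeAbelianGroup.of (Quotient.mk _ E)

/-- The relations `[E] = [E'] + [E'']` for short exact sequences. They are stable under
tensoring with any `(F, g)` (as `F` is flat), so the ideal they generate is the subgroup they
generate. -/
noncomputable def exactIdeal (A : Type u) [CommRing A] : Ideal (FreeAbelianGroup (EndClass A)) :=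
  Ideal.span {r | ∃ E' E E'' : EndObj A, EndObj.ShortExact E' E E'' ∧
    r = freeClass E - freeClass E' - freeClass E''}

/-- The Grothendieck ring `K₀` of the category of endomorphisms of finitely generated projective
`A`-modules, with product induced by the tensor product. -/
noncomputable abbrev K0End (A : Type u) [CommRing A] : Type (u + 1) :=
  FreeAbelianGroup (EndClass A) ⧸ exactIdeal A

/-- The ideal `K₀(A)` of `K0End A` generated by the pairs `(E, 0)`. -/
noncomputable def zeroIdeal (A : Type u) [CommRing A] : Ideal (K0End A) :=
  Ideal.span {r | ∃ E : EndObj A, E.f = 0 ∧ r = Ideal.Quotient.mk (exactIdeal A) (freeClass E)}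

/-- `W₀(A)`, the quotient of `K0End A` by the ideal generated by the pairs `(E, 0)`. -/
noncomputable abbrev W0 (A : Type u) [CommRing A] : Type (u + 1) := K0End A ⧸ zeroIdeal A

/-- The class `[E, f]` in `W₀(A)`. -/
noncomputable def W0.mk (E : EndObj A) : W0 A :=
  Ideal.Quotient.mk (zeroIdeal A) (Ideal.Quotient.mk (exactIdeal A) (freeClass E))

/-- `det(1 - t M(f))` for an endomorphism `f` of a finitely generated projective module `E`:
choose a presentation of `E` as a direct summand of some `Aⁿ`, i.e. `p : Aⁿ → E` and
`s : E → Aⁿ` with `p ∘ s = id`, and take the reverse characteristic polynomial of the matrix of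
`s ∘ f ∘ p` (which is `f ⊕ 0`). It is independent of the choice and is the
usual determinant when `E` is free, see the next two theorems. -/
noncomputable def EndObj.charDet (E : EndObj A) : A[X] :=
  let h := Module.Finite.exists_comp_eq_id_of_projective A E.carrier
  (LinearMap.toMatrix' (h.choose_spec.choose_spec.choose ∘ₗ E.f ∘ₗ
    h.choose_spec.choose)).charpolyRev

theorem charpolyRev_toMatrix'_comm {m n : Type*} [Fintype m] [Fintype n] [DecidableEq m]
    [DecidableEq n] (a : (m → A) →ₗ[A] (n → A)) (b : (n → A) →ₗ[A] (m → A)) :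
    (LinearMap.toMatrix' (a ∘ₗ b)).charpolyRev = (LinearMap.toMatrix' (b ∘ₗ a)).charpolyRev := by
  rw [LinearMap.toMatrix'_comp, LinearMap.toMatrix'_comp, Matrix.charpolyRev, Matrix.charpolyRev,
    Matrix.map_mul, Matrix.map_mul, ← Matrix.smul_mul, Matrix.det_one_sub_mul_comm,
    Matrix.mul_smul]

theorem EndObj.charDet_eq (E : EndObj A) {n : Type*} [Fintype n] [DecidableEq n]
    (p : (n → A) →ₗ[A] E.carrier) (s : E.carrier →ₗ[A] (n → A)) (h : p ∘ₗ s = .id) :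
    E.charDet = (LinearMap.toMatrix' (s ∘ₗ E.f ∘ₗ p)).charpolyRev := by
  set H := Module.Finite.exists_comp_eq_id_of_projective A E.carrier with hH
  have h' := H.choose_spec.choose_spec.choose_spec.2.2
  change (LinearMap.toMatrix' (H.choose_spec.choose_spec.choose ∘ₗ E.f ∘ₗ
    H.choose_spec.choose)).charpolyRev = _
  generalize H.choose_spec.choose_spec.choose = s' at *
  generalize H.choose_spec.choose = p' at *
  have e1 : s' ∘ₗ E.f ∘ₗ p' = (s' ∘ₗ p) ∘ₗ (s ∘ₗ E.f ∘ₗ p') := by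
    have k : ∀ y, p (s y) = y := LinearMap.congr_fun h
    refine LinearMap.ext fun x => ?_
    simp only [LinearMap.comp_apply, k]
  have e2 : s ∘ₗ E.f ∘ₗ p = (s ∘ₗ E.f ∘ₗ p') ∘ₗ (s' ∘ₗ p) := by
    have k : ∀ y, p' (s' y) = y := LinearMap.congr_fun h'
    refine LinearMap.ext fun x => ?_
    simp only [LinearMap.comp_apply, k]
  rw [e1, e2, charpolyRev_toMatrix'_comm]

theorem EndObj.charDet_eq_of_basis (E : EndObj A) {n : Type*} [Fintype n] [DecidableEq n]
    (b : Module.Basis n A E.carrier) :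
    E.charDet = (LinearMap.toMatrix b b E.f).charpolyRev := by
  rw [E.charDet_eq b.equivFun.symm.toLinearMap b.equivFun.toLinearMap (by ext; simp)]
  congr 1

end WZero

/-! ### The `q`-deformed big Witt ring `W^q(A)` -/

section QWitt

/-- The underlying set of `W^q(A)`: sequences `(x₁, x₂, …)` of elements of `A`. -/
@[ext]
structure QWitt (q : ℕ) (A : Type u) : Type u where
  comp : ℕ+ → A

variable {A B : Type*} [CommRing A] [CommRing B] {q : ℕ}

/-- The `q`-deformed ghost component `Φ^q_n(x) = ∑_{d ∣ n} d q^{n/d - 1} x_d^{n/d}`. -/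
noncomputable def ghost (q : ℕ) (x : ℕ+ → A) (n : ℕ+) : A :=
  ∑ d ∈ (n : ℕ).divisors, (d : A) * (q : A) ^ ((n : ℕ) / d - 1) * x d.toPNat' ^ ((n : ℕ) / d)

theorem toPNat'_le {n : ℕ+} {d : ℕ} (hd : d ∈ (n : ℕ).divisors) : d.toPNat' ≤ n := by
  have h0 := Nat.pos_of_mem_divisors hd
  have := Nat.divisor_le hd
  rw [← PNat.coe_le_coe, Nat.toPNat'_coe, if_pos h0]
  exact this

theorem ghost_congr {x y : ℕ+ → A} {n : ℕ+} (h : ∀ m ≤ n, x m = y m) :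
    ghost q x n = ghost q y n :=
  Finset.sum_congr rfl fun d hd => by rw [h _ (toPNat'_le hd)]

theorem map_ghost (φ : A →+* B) (x : ℕ+ → A) (n : ℕ+) :
    ghost q (fun m => φ (x m)) n = φ (ghost q x n) := by
  simp [ghost]

/-- The ghost component splits off its last term. -/
theorem ghost_update (x : ℕ+ → A) (n : ℕ+) (y : A) :
    ghost q (Function.update x n y) n = ghost q (Function.update x n 0) n + n * y := by
  have hn : (n : ℕ) ∈ (n : ℕ).divisors := by simp
  have hn' : (n : ℕ).toPNat' = n := PNat.coe_toPNat' n
  unfold ghost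
  rw [← Finset.add_sum_erase _ _ hn, ← Finset.add_sum_erase _ _ hn]
  simp only [hn', Function.update_self, Nat.div_self n.pos]
  rw [add_comm _ ((n : A) * y)]
  simp only [Nat.sub_self, pow_zero, mul_one, pow_one, mul_zero, zero_add]
  congr 1
  refine Finset.sum_congr rfl fun d hd => ?_
  have h1 := Finset.ne_of_mem_erase hd
  have h2 := Nat.pos_of_mem_divisors (Finset.mem_of_mem_erase hd)
  have : d.toPNat' ≠ n := by
    intro h
    apply h1
    rw [← h, Nat.toPNat'_coe, if_pos h2]
  rw [Function.update_of_ne this, Function.update_of_ne this]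

theorem ghost_eq_add (x : ℕ+ → A) (n : ℕ+) :
    ghost q x n = ghost q (Function.update x n 0) n + n * x n := by
  rw [← ghost_update, Function.update_eq_self]

/-- Over a domain of characteristic zero a sequence is determined by its ghost components. -/
theorem ghost_injective_aux [IsDomain A] [CharZero A] {x y : ℕ+ → A} {N : ℕ+}
    (h : ∀ n ≤ N, ghost q x n = ghost q y n) : ∀ n ≤ N, x n = y n := by
  intro n
  induction n using PNat.strongInductionOn with
  | _ n ih =>
    intro hn
    have e := h n hn
    rw [ghost_eq_add x, ghost_eq_add y, ghost_congr (x := Function.update x n 0)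
      (y := Function.update y n 0)] at e
    · have h0 : (n : A) ≠ 0 := by exact_mod_cast n.ne_zero
      exact mul_left_cancel₀ h0 (add_left_cancel e)
    · intro m hm
      rcases hm.lt_or_eq with h1 | h1
      · rw [Function.update_of_ne h1.ne, Function.update_of_ne h1.ne, ih m h1 (h1.le.trans hn)]
      · subst h1; simp

/-- The congruences satisfied by ghost vectors, with respect to a family `φ` of lifts of
Frobenius. -/
def IsGhostly (q : ℕ) (φ : ℕ → A →+* A) (a : ℕ+ → A) : Prop :=
  ∀ p : ℕ, p.Prime → ∀ n : ℕ+,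
    (p ∣ q → (p : A) ^ (n : ℕ).factorization p ∣ a n) ∧
    (¬ p ∣ q → ∀ m : ℕ+, (n : ℕ) = p * m →
      (p : A) ^ (n : ℕ).factorization p ∣ a n - φ p (a m))

theorem pow_factorization_dvd_cast {A : Type*} [CommRing A] {p d n : ℕ} (hp : p.Prime) (hd : d ≠ 0)
    (h : n ≤ d.factorization p) : (p : A) ^ n ∣ (d : A) := by
  have : p ^ n ∣ d := (hp.pow_dvd_iff_le_factorization hd).2 h
  exact_mod_cast Nat.cast_dvd_cast (α := A) this

theorem isGhostly_ghost (φ : ℕ → A →+* A)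
    (hφ : ∀ p : ℕ, p.Prime → ∀ a, (p : A) ∣ φ p a - a ^ p) (x : ℕ+ → A) :
    IsGhostly q φ (ghost q x) := by
  intro p hp n
  refine ⟨fun hq => ?_, fun hq m hm => ?_⟩
  · refine Finset.dvd_sum fun d hd => Dvd.dvd.mul_right ?_ _
    have hd' := (Nat.mem_divisors.1 hd).1
    obtain ⟨k, hk⟩ := hd'
    have hd0 := Nat.pos_of_mem_divisors hd
    have hk0 : k ≠ 0 := by rintro rfl; simp at hk
    have h1 : (n : ℕ).factorization p = d.factorization p + k.factorization p := by
      rw [hk, Nat.factorization_mul hd0.ne' hk0]; rfl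
    have h2 : (n : ℕ) / d = k := by rw [hk, Nat.mul_div_cancel_left _ hd0]
    have h3 : k.factorization p < k := Nat.factorization_lt p hk0
    rw [h1, pow_add, h2]
    refine mul_dvd_mul (pow_factorization_dvd_cast hp hd0.ne' le_rfl) ?_
    have h4 : (p : A) ∣ (q : A) := Nat.cast_dvd_cast hq
    exact (pow_dvd_pow _ (by omega)).trans (pow_dvd_pow_of_dvd h4 _)
  · have hsub : (m : ℕ).divisors ⊆ (n : ℕ).divisors :=
      Nat.divisors_subset_of_dvd n.ne_zero (hm ▸ Dvd.intro_left p rfl)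
    have e : ghost q x n - φ p (ghost q x m) =
        ∑ d ∈ (n : ℕ).divisors \ (m : ℕ).divisors,
          (d : A) * (q : A) ^ ((n : ℕ) / d - 1) * x d.toPNat' ^ ((n : ℕ) / d) +
        ∑ d ∈ (m : ℕ).divisors,
          ((d : A) * (q : A) ^ ((n : ℕ) / d - 1) * x d.toPNat' ^ ((n : ℕ) / d) -
          (d : A) * (q : A) ^ ((m : ℕ) / d - 1) * φ p (x d.toPNat') ^ ((m : ℕ) / d)) := by
      rw [Finset.sum_sub_distrib, ← add_sub_assoc, Finset.sum_sdiff hsub]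
      simp [ghost]
    rw [e]
    refine dvd_add (Finset.dvd_sum fun d hd => ?_) (Finset.dvd_sum fun d hd => ?_)
    · rw [Finset.mem_sdiff] at hd
      obtain ⟨hd1, hd2⟩ := hd
      have hd0 := Nat.pos_of_mem_divisors hd1
      obtain ⟨k, hk⟩ := (Nat.mem_divisors.1 hd1).1
      have hk0 : k ≠ 0 := by rintro rfl; simp at hk
      have h1 : (n : ℕ).factorization p = d.factorization p + k.factorization p := by
        rw [hk, Nat.factorization_mul hd0.ne' hk0]; rfl
      have hpk : ¬ p ∣ k := by
        rintro ⟨j, rfl⟩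
        apply hd2
        rw [Nat.mem_divisors]
        refine ⟨⟨j, ?_⟩, m.ne_zero⟩
        have : p * (m : ℕ) = p * (d * j) := by rw [← hm, hk]; ring
        exact Nat.eq_of_mul_eq_mul_left hp.pos this
      rw [mul_assoc]
      refine Dvd.dvd.mul_right (pow_factorization_dvd_cast hp hd0.ne' ?_) _
      rw [h1, Nat.factorization_eq_zero_of_not_dvd hpk, add_zero]
    · have hd0 := Nat.pos_of_mem_divisors hd
      obtain ⟨k, hk⟩ := (Nat.mem_divisors.1 hd).1
      have hk0 : k ≠ 0 := by rintro rfl; simp at hk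
      have hnd : (n : ℕ) / d = p * k := by
        rw [hm, hk, show p * (d * k) = d * (p * k) by ring, Nat.mul_div_cancel_left _ hd0]
      have hmd : (m : ℕ) / d = k := by rw [hk, Nat.mul_div_cancel_left _ hd0]
      have h1 : (n : ℕ).factorization p = d.factorization p + (k.factorization p + 1) := by
        rw [hm, hk, Nat.factorization_mul hp.ne_zero (by positivity),
          Nat.factorization_mul hd0.ne' hk0]
        simp [hp.factorization_self]; ring
      rw [hnd, hmd, h1, pow_add, mul_assoc, mul_assoc, ← mul_sub]
      refine mul_dvd_mul (pow_factorization_dvd_cast hp hd0.ne' le_rfl) ?_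
      set y := x d.toPNat'
      have hcop : IsCoprime ((p : A) ^ (k.factorization p + 1)) (q : A) := by
        have : Nat.Coprime (p ^ (k.factorization p + 1)) q :=
          Nat.Coprime.pow_left _ ((Nat.Prime.coprime_iff_not_dvd hp).2 hq)
        have := (Nat.isCoprime_iff_coprime.2 this).map (Int.castRingHom A)
        simpa using this
      refine hcop.dvd_of_dvd_mul_left ?_
      have hpk : p * k ≠ 0 := mul_ne_zero hp.ne_zero hk0
      have e2 : (q : A) * ((q : A) ^ (p * k - 1) * y ^ (p * k) - (q : A) ^ (k - 1) * φ p y ^ k) =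
          (((q : A) * y) ^ p) ^ k - (φ p (q * y)) ^ k := by
        rw [mul_sub, ← mul_assoc, ← mul_assoc, mul_pow_sub_one hpk, mul_pow_sub_one hk0, map_mul,
          map_natCast, mul_pow, mul_pow, ← pow_mul, mul_pow, ← pow_mul]
      rw [e2]
      have h5 : (p : A) ∣ ((q : A) * y) ^ p - φ p (q * y) := (dvd_sub_comm).1 (hφ p hp _)
      obtain ⟨j, hj⟩ := Nat.ordProj_dvd k p
      have h6 := dvd_sub_pow_of_dvd_sub h5 (k.factorization p)
      refine h6.trans ?_
      conv_rhs => rw [hj, pow_mul, pow_mul]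
      exact sub_dvd_pow_sub_pow _ _ _

theorem natCast_dvd_of_prime_pow {A : Type*} [CommRing A] {n : ℕ} (hn : n ≠ 0) {r : A}
    (h : ∀ p : ℕ, p.Prime → (p : A) ^ n.factorization p ∣ r) : (n : A) ∣ r := by
  have e : (n : A) = ∏ p ∈ n.primeFactors, (p : A) ^ n.factorization p := by
    conv_lhs => rw [← Nat.prod_factorization_pow_eq_self hn, Finsupp.prod]
    simp
  rw [e]
  refine Finset.prod_dvd_of_coprime ?_ fun p hp => h p (Nat.prime_of_mem_primeFactors hp)
  intro a ha b hb hab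
  have : Nat.Coprime (a ^ n.factorization a) (b ^ n.factorization b) :=
    Nat.Coprime.pow _ _ ((Nat.coprime_primes (Nat.prime_of_mem_primeFactors ha)
      (Nat.prime_of_mem_primeFactors hb)).2 hab)
  simpa using (Nat.isCoprime_iff_coprime.2 this).map (Int.castRingHom A)

theorem exists_ghost_eq_aux (φ : ℕ → A →+* A)
    (hφ : ∀ p : ℕ, p.Prime → ∀ a, (p : A) ∣ φ p a - a ^ p) (a : ℕ+ → A)
    (ha : IsGhostly q φ a) (N : ℕ+) : ∃ x : ℕ+ → A, ∀ n < N, ghost q x n = a n := by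
  induction N using PNat.recOn with
  | one => exact ⟨0, fun n hn => absurd hn (not_lt.2 one_le)⟩
  | succ N ih =>
    obtain ⟨x, hx⟩ := ih
    set x' := Function.update x N 0 with hx'
    have hx1 : ∀ n < N, ghost q x' n = a n := fun n hn => by
      rw [← hx n hn]
      exact ghost_congr fun m hm => Function.update_of_ne (hm.trans_lt hn).ne _ _
    have hg := isGhostly_ghost (q := q) φ hφ x'
    have hdvd : ((N : ℕ) : A) ∣ a N - ghost q x' N := by
      refine natCast_dvd_of_prime_pow N.ne_zero fun p hp => ?_
      by_cases hpN : p ∣ N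
      · by_cases hq : p ∣ q
        · exact dvd_sub ((ha p hp N).1 hq) ((hg p hp N).1 hq)
        · obtain ⟨k, hk⟩ := hpN
          have hk0 : 0 < k := Nat.pos_of_ne_zero (by rintro rfl; simp at hk)
          lift k to ℕ+ using hk0
          have h1 := (ha p hp N).2 hq k hk
          have h2 := (hg p hp N).2 hq k hk
          have hlt : k < N := by
            rw [← PNat.coe_lt_coe, hk]
            exact lt_mul_of_one_lt_left k.pos hp.one_lt
          rw [hx1 _ hlt] at h2
          simpa using dvd_sub h1 h2
      · rw [Nat.factorization_eq_zero_of_not_dvd hpN, pow_zero]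
        exact one_dvd _
    obtain ⟨y, hy⟩ := hdvd
    refine ⟨Function.update x N y, fun n hn => ?_⟩
    rcases (PNat.lt_add_one_iff.1 hn).lt_or_eq with h | rfl
    · rw [← hx n h]
      exact ghost_congr fun m hm => Function.update_of_ne (hm.trans_lt h).ne _ _
    · rw [ghost_update, ← hx', ← hy]; ring

/-- Integrality: vectors satisfying the congruences are ghost vectors. -/
theorem exists_ghost_eq [IsDomain A] [CharZero A] (φ : ℕ → A →+* A)
    (hφ : ∀ p : ℕ, p.Prime → ∀ a, (p : A) ∣ φ p a - a ^ p) (a : ℕ+ → A)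
    (ha : IsGhostly q φ a) : ∃ x : ℕ+ → A, ∀ n, ghost q x n = a n := by
  choose X hX using exists_ghost_eq_aux φ hφ a ha
  refine ⟨fun n => X (n + 1) n, fun n => ?_⟩
  rw [← hX (n + 1) n (PNat.lt_add_one_iff.2 le_rfl)]
  refine ghost_congr fun m hm => ?_
  refine ghost_injective_aux (q := q) (N := m) (fun k hk => ?_) m le_rfl
  rw [hX _ _ (PNat.lt_add_one_iff.2 hk), hX _ _ (PNat.lt_add_one_iff.2 (hk.trans hm))]

theorem IsGhostly.add {φ : ℕ → A →+* A} {a b : ℕ+ → A} (ha : IsGhostly q φ a)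
    (hb : IsGhostly q φ b) : IsGhostly q φ (a + b) := fun p hp n =>
  ⟨fun hq => dvd_add ((ha p hp n).1 hq) ((hb p hp n).1 hq), fun hq m hm => by
    have := dvd_add ((ha p hp n).2 hq m hm) ((hb p hp n).2 hq m hm)
    rwa [← add_sub_add_comm, ← map_add] at this⟩

theorem IsGhostly.neg {φ : ℕ → A →+* A} {a : ℕ+ → A} (ha : IsGhostly q φ a) :
    IsGhostly q φ (-a) := fun p hp n =>
  ⟨fun hq => (dvd_neg.2 ((ha p hp n).1 hq)), fun hq m hm => by
    have := dvd_neg.2 ((ha p hp n).2 hq m hm)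
    simpa [neg_sub, sub_eq_add_neg, add_comm] using this⟩

theorem IsGhostly.mul {φ : ℕ → A →+* A} {a b : ℕ+ → A} (ha : IsGhostly q φ a)
    (hb : IsGhostly q φ b) : IsGhostly q φ (a * b) := fun p hp n =>
  ⟨fun hq => Dvd.dvd.mul_right ((ha p hp n).1 hq) _, fun hq m hm => by
    have := dvd_add (Dvd.dvd.mul_right ((ha p hp n).2 hq m hm) (b n))
      (Dvd.dvd.mul_left ((hb p hp n).2 hq m hm) (φ p (a m)))
    convert this using 1
    simp only [Pi.mul_apply, map_mul]; ring⟩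

/-- The polynomial ring `ℤ[X₁, X₂, …, Y₁, Y₂, …]`. -/
abbrev UnivRing : Type := MvPolynomial (ℕ+ ⊕ ℕ+) ℤ

/-- The generic sequence `X`. -/
noncomputable def genX (n : ℕ+) : UnivRing := MvPolynomial.X (Sum.inl n)

/-- The generic sequence `Y`. -/
noncomputable def genY (n : ℕ+) : UnivRing := MvPolynomial.X (Sum.inr n)

theorem frobenius_lift (p : ℕ) (hp : p.Prime) (a : UnivRing) :
    (p : UnivRing) ∣ (MvPolynomial.expand p : UnivRing →ₐ[ℤ] UnivRing).toRingHom a - a ^ p := by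
  have := Fact.mk hp
  have : (p : UnivRing) = MvPolynomial.C (p : ℤ) := by simp
  rw [this, MvPolynomial.C_dvd_iff_zmod, map_sub, sub_eq_zero, map_pow, ← MvPolynomial.expand_zmod]
  exact MvPolynomial.map_expand _ _ _

theorem exists_univ (a : ℕ+ → UnivRing) (ha : IsGhostly q (fun p =>
    (MvPolynomial.expand p : UnivRing →ₐ[ℤ] UnivRing).toRingHom) a) :
    ∃ S : ℕ+ → UnivRing, ∀ n, ghost q S n = a n :=
  exists_ghost_eq _ frobenius_lift a ha

theorem exists_univ_add (q : ℕ) :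
    ∃ S : ℕ+ → UnivRing, ∀ n, ghost q S n = ghost q genX n + ghost q genY n :=
  exists_univ _ ((isGhostly_ghost _ frobenius_lift _).add (isGhostly_ghost _ frobenius_lift _))

theorem exists_univ_mul (q : ℕ) :
    ∃ S : ℕ+ → UnivRing, ∀ n, ghost q S n = ghost q genX n * ghost q genY n :=
  exists_univ _ ((isGhostly_ghost _ frobenius_lift _).mul (isGhostly_ghost _ frobenius_lift _))

theorem exists_univ_neg (q : ℕ) :
    ∃ S : ℕ+ → UnivRing, ∀ n, ghost q S n = - ghost q genX n :=
  exists_univ _ (isGhostly_ghost _ frobenius_lift _).neg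

/-- The unique integral polynomials with `Φ^q(S) = Φ^q(X) + Φ^q(Y)`. -/
noncomputable def addPoly (q : ℕ) : ℕ+ → UnivRing := (exists_univ_add q).choose

/-- The unique integral polynomials with `Φ^q(P) = Φ^q(X) Φ^q(Y)`. -/
noncomputable def mulPoly (q : ℕ) : ℕ+ → UnivRing := (exists_univ_mul q).choose

/-- The unique integral polynomials with `Φ^q(N) = -Φ^q(X)`. -/
noncomputable def negPoly (q : ℕ) : ℕ+ → UnivRing := (exists_univ_neg q).choose

/-- Evaluation of a sequence of universal polynomials at a pair of sequences in `A`. -/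
noncomputable def evalPoly (S : ℕ+ → UnivRing) (x y : ℕ+ → A) (n : ℕ+) : A :=
  MvPolynomial.eval₂Hom (Int.castRingHom A) (Sum.elim x y) (S n)

namespace QWitt

noncomputable instance : Zero (QWitt q A) := ⟨⟨fun _ => 0⟩⟩
noncomputable instance : Add (QWitt q A) := ⟨fun x y => ⟨evalPoly (addPoly q) x.comp y.comp⟩⟩
noncomputable instance : Mul (QWitt q A) := ⟨fun x y => ⟨evalPoly (mulPoly q) x.comp y.comp⟩⟩
noncomputable instance : Neg (QWitt q A) := ⟨fun x => ⟨evalPoly (negPoly q) x.comp x.comp⟩⟩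

theorem ghost_zero (n : ℕ+) : ghost q (0 : QWitt q A).comp n = 0 := by
  refine Finset.sum_eq_zero fun d hd => ?_
  have : (n : ℕ) / d ≠ 0 := by
    have := Nat.div_pos (Nat.divisor_le hd) (Nat.pos_of_mem_divisors hd)
    omega
  change _ * (0 : A) ^ _ = 0
  rw [zero_pow this, mul_zero]

theorem ghost_evalPoly (S : ℕ+ → UnivRing) (x y : ℕ+ → A) (n : ℕ+) :
    ghost q (evalPoly S x y) n =
      MvPolynomial.eval₂Hom (Int.castRingHom A) (Sum.elim x y) (ghost q S n) :=
  map_ghost _ S n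

theorem eval_genX (x y : ℕ+ → A) (n : ℕ+) :
    MvPolynomial.eval₂Hom (Int.castRingHom A) (Sum.elim x y) (ghost q genX n) = ghost q x n := by
  rw [← map_ghost]
  simp [genX]

theorem eval_genY (x y : ℕ+ → A) (n : ℕ+) :
    MvPolynomial.eval₂Hom (Int.castRingHom A) (Sum.elim x y) (ghost q genY n) = ghost q y n := by
  rw [← map_ghost]
  simp [genY]

theorem ghost_add (x y : QWitt q A) (n : ℕ+) :
    ghost q (x + y).comp n = ghost q x.comp n + ghost q y.comp n := by
  refine (ghost_evalPoly (addPoly q) x.comp y.comp n).trans ?_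
  rw [addPoly, (exists_univ_add q).choose_spec, map_add, eval_genX, eval_genY]

theorem ghost_mul (x y : QWitt q A) (n : ℕ+) :
    ghost q (x * y).comp n = ghost q x.comp n * ghost q y.comp n := by
  refine (ghost_evalPoly (mulPoly q) x.comp y.comp n).trans ?_
  rw [mulPoly, (exists_univ_mul q).choose_spec, map_mul, eval_genX, eval_genY]

theorem ghost_neg (x : QWitt q A) (n : ℕ+) : ghost q (-x).comp n = - ghost q x.comp n := by
  refine (ghost_evalPoly (negPoly q) x.comp x.comp n).trans ?_
  rw [negPoly, (exists_univ_neg q).choose_spec, map_neg, eval_genX]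

theorem ghost_inj [IsDomain A] [CharZero A] {x y : QWitt q A}
    (h : ∀ n, ghost q x.comp n = ghost q y.comp n) : x = y :=
  QWitt.ext <| funext fun n => ghost_injective_aux (q := q) (N := n) (fun m _ => h m) n le_rfl

/-- A ring homomorphism acts on sequences componentwise. -/
def mapFun (φ : A →+* B) (x : QWitt q A) : QWitt q B := ⟨fun n => φ (x.comp n)⟩

theorem map_evalPoly (φ : A →+* B) (S : ℕ+ → UnivRing) (x y : ℕ+ → A) :
    (fun n => φ (evalPoly S x y n)) = evalPoly S (fun n => φ (x n)) fun n => φ (y n) := by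
  funext n
  unfold evalPoly
  rw [← RingHom.comp_apply]
  congr 1
  ext i
  · simp
  · rcases i with i | i <;> simp

theorem mapFun_zero (φ : A →+* B) : mapFun φ (0 : QWitt q A) = 0 :=
  QWitt.ext <| funext fun _ => map_zero φ

theorem mapFun_add (φ : A →+* B) (x y : QWitt q A) :
    mapFun φ (x + y) = mapFun φ x + mapFun φ y :=
  QWitt.ext <| map_evalPoly φ (addPoly q) x.comp y.comp

theorem mapFun_mul (φ : A →+* B) (x y : QWitt q A) :
    mapFun φ (x * y) = mapFun φ x * mapFun φ y :=
  QWitt.ext <| map_evalPoly φ (mulPoly q) x.comp y.comp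

theorem mapFun_neg (φ : A →+* B) (x : QWitt q A) :
    mapFun φ (-x) = - mapFun φ x :=
  QWitt.ext <| map_evalPoly φ (negPoly q) x.comp x.comp

/-- The canonical surjection `ℤ[X_a : a ∈ A] → A`. -/
noncomputable def polyMap (A : Type*) [CommRing A] : MvPolynomial A ℤ →+* A :=
  MvPolynomial.eval₂Hom (Int.castRingHom A) id

theorem mapFun_surjective (A : Type*) [CommRing A] :
    Function.Surjective (mapFun (q := q) (polyMap A)) := fun x =>
  ⟨⟨fun n => MvPolynomial.X (x.comp n)⟩, QWitt.ext <| funext fun n => by simp [mapFun, polyMap]⟩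

/-- `W^q(A)` as a commutative ring. As in general no unit exists in
`W^q(A)` when `q` is even and `A` is for instance `ℤ`, the ring is not required to be unital. -/
noncomputable instance instNonUnitalCommRing :
    NonUnitalCommRing (QWitt q A) where
  nsmul := nsmulRec
  zsmul := zsmulRec
  add_assoc x y z := by
    obtain ⟨x, rfl⟩ := mapFun_surjective A x
    obtain ⟨y, rfl⟩ := mapFun_surjective A y
    obtain ⟨z, rfl⟩ := mapFun_surjective A z
    simp only [← mapFun_add]
    refine congrArg _ (ghost_inj fun n => ?_)
    simp only [ghost_add]
    ring
  zero_add x := by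
    obtain ⟨x, rfl⟩ := mapFun_surjective A x
    simp only [← mapFun_add, ← mapFun_zero (polyMap A)]
    refine congrArg _ (ghost_inj fun n => ?_)
    simp only [ghost_add, ghost_zero]
    ring
  add_zero x := by
    obtain ⟨x, rfl⟩ := mapFun_surjective A x
    simp only [← mapFun_add, ← mapFun_zero (polyMap A)]
    refine congrArg _ (ghost_inj fun n => ?_)
    simp only [ghost_add, ghost_zero]
    ring
  neg_add_cancel x := by
    obtain ⟨x, rfl⟩ := mapFun_surjective A x
    simp only [← mapFun_add, ← mapFun_neg, ← mapFun_zero (polyMap A)]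
    refine congrArg _ (ghost_inj fun n => ?_)
    simp only [ghost_add, ghost_neg, ghost_zero]
    ring
  add_comm x y := by
    obtain ⟨x, rfl⟩ := mapFun_surjective A x
    obtain ⟨y, rfl⟩ := mapFun_surjective A y
    simp only [← mapFun_add]
    refine congrArg _ (ghost_inj fun n => ?_)
    simp only [ghost_add]
    ring
  left_distrib x y z := by
    obtain ⟨x, rfl⟩ := mapFun_surjective A x
    obtain ⟨y, rfl⟩ := mapFun_surjective A y
    obtain ⟨z, rfl⟩ := mapFun_surjective A z
    simp only [← mapFun_add, ← mapFun_mul]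
    refine congrArg _ (ghost_inj fun n => ?_)
    simp only [ghost_add, ghost_mul]
    ring
  right_distrib x y z := by
    obtain ⟨x, rfl⟩ := mapFun_surjective A x
    obtain ⟨y, rfl⟩ := mapFun_surjective A y
    obtain ⟨z, rfl⟩ := mapFun_surjective A z
    simp only [← mapFun_add, ← mapFun_mul]
    refine congrArg _ (ghost_inj fun n => ?_)
    simp only [ghost_add, ghost_mul]
    ring
  zero_mul x := by
    obtain ⟨x, rfl⟩ := mapFun_surjective A x
    simp only [← mapFun_mul, ← mapFun_zero (polyMap A)]
    refine congrArg _ (ghost_inj fun n => ?_)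
    simp only [ghost_mul, ghost_zero]
    ring
  mul_zero x := by
    obtain ⟨x, rfl⟩ := mapFun_surjective A x
    simp only [← mapFun_mul, ← mapFun_zero (polyMap A)]
    refine congrArg _ (ghost_inj fun n => ?_)
    simp only [ghost_mul, ghost_zero]
    ring
  mul_assoc x y z := by
    obtain ⟨x, rfl⟩ := mapFun_surjective A x
    obtain ⟨y, rfl⟩ := mapFun_surjective A y
    obtain ⟨z, rfl⟩ := mapFun_surjective A z
    simp only [← mapFun_mul]
    refine congrArg _ (ghost_inj fun n => ?_)
    simp only [ghost_mul]
    ring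
  mul_comm x y := by
    obtain ⟨x, rfl⟩ := mapFun_surjective A x
    obtain ⟨y, rfl⟩ := mapFun_surjective A y
    simp only [← mapFun_mul]
    refine congrArg _ (ghost_inj fun n => ?_)
    simp only [ghost_mul]
    ring

/-- Functoriality: a ring homomorphism acts componentwise by a homomorphism of rings. -/
def map (φ : A →+* B) : QWitt q A →ₙ+* QWitt q B where
  toFun := mapFun φ
  map_zero' := mapFun_zero φ
  map_add' := mapFun_add φ
  map_mul' := mapFun_mul φ

/-- The ghost map `Φ^q : W^q(A) → gh(A)` is a homomorphism of rings. -/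
noncomputable def ghostMap : QWitt q A →ₙ+* (ℕ+ → A) where
  toFun x := ghost q x.comp
  map_zero' := funext ghost_zero
  map_add' x y := funext (ghost_add x y)
  map_mul' x y := funext (ghost_mul x y)

end QWitt

end QWitt

/-! ### The `q`-deformed ring `Λ^q(A)` -/

section LambdaQ

open PowerSeries

variable {A B : Type*} [CommRing A] [CommRing B] {q : ℕ}

/-- The inverse of a power series with constant term `1`. -/
noncomputable def inv1 (f : A⟦X⟧) : A⟦X⟧ := invOfUnit f 1

/-- The infinite product `∏_{n ≥ 1} u_n`, for power series with `u_n ≡ 1 mod X^n`: its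
coefficient of degree `k` is the one of `∏_{1 ≤ n ≤ k} u_n`. -/
noncomputable def infProd (u : ℕ → A⟦X⟧) : A⟦X⟧ :=
  PowerSeries.mk fun k => coeff k (∏ n ∈ Finset.Icc 1 k, u n)

/-- The factor `1 - a X^n`. -/
noncomputable def factor (a : A) (n : ℕ) : A⟦X⟧ := 1 - C a * X ^ n

/-- The partial products `∏_{1 ≤ n ≤ k} (1 - a_n X^n)^q`, where `a_k` is chosen recursively such
that the product agrees with `h` up to degree `k`. -/
noncomputable def partialProd (q : ℕ) [Invertible (q : A)] (h : A⟦X⟧) : ℕ → A⟦X⟧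
  | 0 => 1
  | k + 1 => partialProd q h k *
      factor (⅟(q : A) * (coeff (k + 1) (partialProd q h k) - coeff (k + 1) h)) (k + 1) ^ q

/-- When `q` is invertible, every power series `f` with constant term `1` is in a unique way
a product `f = ∏_{n ≥ 1} (1 - a_n X^n)^{-q}`; `coord q f n` is the coefficient `a_n`. -/
noncomputable def coord (q : ℕ) [Invertible (q : A)] (f : A⟦X⟧) (n : ℕ) : A :=
  ⅟(q : A) * (coeff n (partialProd q (inv1 f) (n - 1)) - coeff n (inv1 f))

/-- The underlying set of `Λ^q(A)`: the power series with constant term `1`. -/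
@[ext]
structure LambdaQ (q : ℕ) (A : Type u) [CommRing A] : Type u where
  val : A⟦X⟧
  const : constantCoeff val = 1

theorem mul_inv1 {f : A⟦X⟧} (h : constantCoeff f = 1) : f * inv1 f = 1 :=
  mul_invOfUnit f 1 h

theorem const_inv1 (f : A⟦X⟧) : constantCoeff (inv1 f) = 1 := by simp [inv1]

theorem inv1_eq {f g : A⟦X⟧} (h : constantCoeff f = 1) (e : f * g = 1) : inv1 f = g := by
  calc inv1 f = (f * g) * inv1 f := by rw [e, one_mul]
    _ = (f * inv1 f) * g := by ring
    _ = g := by rw [mul_inv1 h, one_mul]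

theorem inv1_inv1 {f : A⟦X⟧} (h : constantCoeff f = 1) : inv1 (inv1 f) = f :=
  inv1_eq (const_inv1 f) (by rw [mul_comm, mul_inv1 h])

theorem map_inv1 (φ : A →+* B) {f : A⟦X⟧} (h : constantCoeff f = 1) :
    PowerSeries.map φ (inv1 f) = inv1 (PowerSeries.map φ f) := by
  refine (inv1_eq ?_ ?_).symm
  · rw [← coeff_zero_eq_constantCoeff_apply, coeff_map, coeff_zero_eq_constantCoeff_apply, h,
      map_one]
  · rw [← map_mul, mul_inv1 h, map_one]

theorem const_infProd (u : ℕ → A⟦X⟧) : constantCoeff (infProd u) = 1 := by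
  rw [← coeff_zero_eq_constantCoeff_apply, infProd, coeff_mk]
  simp

theorem const_of_dvd {n : ℕ} (hn : 1 ≤ n) {f : A⟦X⟧} (h : X ^ n ∣ f - 1) :
    constantCoeff f = 1 := by
  have : coeff 0 (f - 1) = 0 := X_pow_dvd_iff.1 h 0 (by omega)
  rw [map_sub, sub_eq_zero] at this
  simpa using this

theorem prod_dvd_sub_one {m : ℕ} (s : Finset ℕ) (u : ℕ → A⟦X⟧) (h : ∀ n ∈ s, X ^ m ∣ u n - 1) :
    X ^ m ∣ (∏ n ∈ s, u n) - 1 := by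
  refine Finset.prod_induction _ (fun f => X ^ m ∣ f - 1) (fun a b ha hb => ?_) (by simp) h
  have := dvd_add (Dvd.dvd.mul_right ha b) hb
  convert this using 1
  ring

theorem infProd_dvd_sub_one {m : ℕ} (u : ℕ → A⟦X⟧) (h : ∀ n, 1 ≤ n → X ^ m ∣ u n - 1) :
    X ^ m ∣ infProd u - 1 := by
  refine X_pow_dvd_iff.2 fun k hk => ?_
  have := X_pow_dvd_iff.1 (prod_dvd_sub_one (Finset.Icc 1 k) u
    fun n hn => h n (Finset.mem_Icc.1 hn).1) k hk
  rwa [map_sub, infProd, coeff_mk, ← map_sub]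

theorem infProd_approx (u : ℕ → A⟦X⟧) (h : ∀ n, 1 ≤ n → X ^ n ∣ u n - 1) (N : ℕ) :
    X ^ (N + 1) ∣ infProd u - ∏ n ∈ Finset.Icc 1 N, u n := by
  refine X_pow_dvd_iff.2 fun k hk => ?_
  rw [map_sub, infProd, coeff_mk, sub_eq_zero]
  induction N, (Nat.lt_succ_iff.1 hk) using Nat.le_induction with
  | base => rfl
  | succ N hN ih =>
    rw [ih (by omega), Finset.prod_Icc_succ_top (by omega)]
    have := X_pow_dvd_iff.1 (Dvd.dvd.mul_left (h (N + 1) (by omega))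
      (∏ n ∈ Finset.Icc 1 N, u n)) k (by omega)
    rw [mul_sub, mul_one, map_sub, sub_eq_zero] at this
    exact this.symm

theorem map_infProd (φ : A →+* B) (u : ℕ → A⟦X⟧) :
    PowerSeries.map φ (infProd u) = infProd fun n => PowerSeries.map φ (u n) := by
  ext k
  simp only [infProd, coeff_map, coeff_mk, ← map_prod]

theorem map_factor (φ : A →+* B) (a : A) (n : ℕ) :
    PowerSeries.map φ (factor a n) = factor (φ a) n := by
  simp [factor]

theorem factor_dvd (a : A) {n m : ℕ} (h : n ≤ m) : X ^ n ∣ factor a m - 1 := by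
  rw [factor, sub_sub_cancel_left, dvd_neg]
  exact Dvd.dvd.mul_left (pow_dvd_pow _ h) _

theorem pow_dvd_sub_one {n k : ℕ} {f : A⟦X⟧} (h : X ^ n ∣ f - 1) : X ^ n ∣ f ^ k - 1 := by
  have := sub_dvd_pow_sub_pow f 1 k
  rw [one_pow] at this
  exact h.trans this

theorem map_invOf_natCast (φ : A →+* B) [Invertible (q : A)] [Invertible (q : B)] :
    φ (⅟(q : A)) = ⅟(q : B) := by
  refine (invOf_eq_right_inv ?_).symm
  rw [← map_natCast φ q, ← map_mul, mul_invOf_self, map_one]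

theorem map_partialProd (φ : A →+* B) [Invertible (q : A)] [Invertible (q : B)] (h : A⟦X⟧)
    (k : ℕ) : PowerSeries.map φ (partialProd q h k) = partialProd q (PowerSeries.map φ h) k := by
  induction k with
  | zero => simp [partialProd]
  | succ k ih =>
    rw [partialProd, partialProd, map_mul, map_pow, map_factor, ih, map_mul, map_invOf_natCast,
      map_sub, ← coeff_map, ← coeff_map, ih]

theorem map_coord (φ : A →+* B) [Invertible (q : A)] [Invertible (q : B)] {f : A⟦X⟧}
    (hf : constantCoeff f = 1) (n : ℕ) :
    φ (coord q f n) = coord q (PowerSeries.map φ f) n := by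
  rw [coord, coord, map_mul, map_invOf_natCast, map_sub, ← coeff_map, ← coeff_map,
    map_partialProd, map_inv1 φ hf]

theorem partialProd_eq [Invertible (q : A)] (f : A⟦X⟧) (k : ℕ) :
    partialProd q (inv1 f) k = ∏ n ∈ Finset.Icc 1 k, factor (coord q f n) n ^ q := by
  induction k with
  | zero => simp [partialProd]
  | succ k ih =>
    rw [Finset.prod_Icc_succ_top (by omega), ← ih]
    rfl

theorem coeff_mul_factor_pow (P : A⟦X⟧) (hP : constantCoeff P = 1) (a : A) (k : ℕ) :
    coeff (k + 1) (P * factor a (k + 1) ^ q) = coeff (k + 1) P - q * a := by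
  have h1 : X ^ (k + 2) ∣ P * factor a (k + 1) ^ q - (P - C ((q : A) * a) * X ^ (k + 1)) := by
    induction q with
    | zero => simp
    | succ q ih =>
      have e : P * factor a (k + 1) ^ (q + 1) - (P - C (((q + 1 : ℕ) : A) * a) * X ^ (k + 1)) =
          (P * factor a (k + 1) ^ q - (P - C ((q : A) * a) * X ^ (k + 1))) * factor a (k + 1)
          - (P - 1) * (C a * X ^ (k + 1)) + C ((q : A) * a) * C a * X ^ (k + 1) * X ^ (k + 1) := by
        simp only [factor, Nat.cast_add, Nat.cast_one, map_mul, map_add, map_one, pow_succ]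
        ring
      rw [e]
      refine dvd_add (dvd_sub (Dvd.dvd.mul_right ih _) ?_) ?_
      · have : X ∣ P - 1 := X_dvd_iff.2 (by simp [hP])
        obtain ⟨r, hr⟩ := this
        exact ⟨r * C a, by rw [hr]; ring⟩
      · exact ⟨C ((q : A) * a) * C a * X ^ k, by ring⟩
  have h2 := X_pow_dvd_iff.1 h1 (k + 1) (by omega)
  rw [map_sub, sub_eq_zero] at h2
  rw [h2, map_sub, coeff_C_mul, coeff_X_pow_self, mul_one]

theorem const_partialProd [Invertible (q : A)] (f : A⟦X⟧) (k : ℕ) :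
    constantCoeff (partialProd q (inv1 f) k) = 1 := by
  rw [partialProd_eq, map_prod]
  refine Finset.prod_eq_one fun n hn => ?_
  rw [map_pow, const_of_dvd (Finset.mem_Icc.1 hn).1 (factor_dvd _ le_rfl), one_pow]

/-- The factorization `f = ∏_{n ≥ 1} (1 - a_n X^n)^{-q}`. -/
theorem infProd_coord [Invertible (q : A)] {f : A⟦X⟧} :
    infProd (fun n => factor (coord q f n) n ^ q) = inv1 f := by
  ext k
  rw [infProd, coeff_mk, ← partialProd_eq]
  cases k with
  | zero =>
    rw [coeff_zero_eq_constantCoeff_apply, coeff_zero_eq_constantCoeff_apply,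
      const_partialProd, const_inv1]
  | succ k =>
    rw [partialProd, coeff_mul_factor_pow _ (const_partialProd f k), mul_invOf_cancel_left']
    ring

/-- The series `∏_{m, n ≥ 1} (1 - a_m^{n/d} b_n^{m/d} X^{lcm(m,n)})^{q d}`, `d = gcd(m,n)`. -/
noncomputable def starProd (q : ℕ) (a b : ℕ → A) : A⟦X⟧ :=
  infProd fun m => infProd fun n =>
    factor (a m ^ (n / m.gcd n) * b n ^ (m / m.gcd n)) (m.lcm n) ^ (q * m.gcd n)

namespace LambdaQ

/-- Addition in `Λ^q(A)` is the product of power series. -/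
noncomputable instance : Add (LambdaQ q A) :=
  ⟨fun f g => ⟨f.val * g.val, by rw [map_mul, f.const, g.const, one_mul]⟩⟩

noncomputable instance : Zero (LambdaQ q A) := ⟨⟨1, by simp⟩⟩

noncomputable instance : Neg (LambdaQ q A) := ⟨fun f => ⟨inv1 f.val, const_inv1 _⟩⟩

/-- The unit of `Λ^q(A)` is `(1 - X)^{-q}`. -/
noncomputable instance : One (LambdaQ q A) := ⟨⟨inv1 (factor 1 1 ^ q), const_inv1 _⟩⟩

/-- The product `⋆_q` of `Λ^q(A)`: the biadditive, continuous and functorial extension of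
`(1 - aX)^{-q} ⋆_q (1 - bX)^{-q} = (1 - abX)^{-q}`. For `f = ∏ (1 - a_m X^m)^{-q}` and
`g = ∏ (1 - b_n X^n)^{-q}` it is
`f ⋆_q g = ∏ (1 - a_m^{n/d} b_n^{m/d} X^{lcm(m,n)})^{-q d}` with `d = gcd(m,n)`, as one sees by
splitting `1 - a X^m` into linear factors. -/
noncomputable instance [Invertible (q : A)] : Mul (LambdaQ q A) :=
  ⟨fun f g => ⟨inv1 (starProd q (coord q f.val) (coord q g.val)), const_inv1 _⟩⟩

theorem val_add (f g : LambdaQ q A) : (f + g).val = f.val * g.val := rfl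

theorem val_zero : (0 : LambdaQ q A).val = 1 := rfl

theorem val_one : (1 : LambdaQ q A).val = inv1 (factor 1 1 ^ q) := rfl

theorem val_mul [Invertible (q : A)] (f g : LambdaQ q A) :
    (f * g).val = inv1 (starProd q (coord q f.val) (coord q g.val)) := rfl

end LambdaQ

/-- The logarithmic derivative `X f' / f`. -/
noncomputable def logDer (f : A⟦X⟧) : A⟦X⟧ := X * d⁄dX A f * inv1 f

theorem logDer_one : logDer (1 : A⟦X⟧) = 0 := by simp [logDer]

theorem logDer_mul {f g : A⟦X⟧} (hf : constantCoeff f = 1) (hg : constantCoeff g = 1) :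
    logDer (f * g) = logDer f + logDer g := by
  have e : inv1 (f * g) = inv1 f * inv1 g := by
    refine inv1_eq (by simp [hf, hg]) ?_
    rw [mul_mul_mul_comm, mul_inv1 hf, mul_inv1 hg, one_mul]
  rw [logDer, logDer, logDer, e, Derivation.leibniz, smul_eq_mul, smul_eq_mul]
  linear_combination (X * d⁄dX A g * inv1 g) * mul_inv1 hf + (X * d⁄dX A f * inv1 f) * mul_inv1 hg

theorem logDer_inv1 {f : A⟦X⟧} (hf : constantCoeff f = 1) : logDer (inv1 f) = - logDer f := by
  rw [eq_neg_iff_add_eq_zero, ← logDer_mul (const_inv1 f) hf, mul_comm, mul_inv1 hf, logDer_one]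

theorem logDer_pow {f : A⟦X⟧} (hf : constantCoeff f = 1) (k : ℕ) :
    logDer (f ^ k) = k * logDer f := by
  induction k with
  | zero => simp [logDer_one]
  | succ k ih => rw [pow_succ, logDer_mul (by simp [hf]) hf, ih]; push_cast; ring

theorem logDer_prod (s : Finset ℕ) (u : ℕ → A⟦X⟧) (h : ∀ n ∈ s, constantCoeff (u n) = 1) :
    logDer (∏ n ∈ s, u n) = ∑ n ∈ s, logDer (u n) := by
  induction s using Finset.cons_induction with
  | empty => simp [logDer_one]
  | cons a s ha ih =>
    have h' : ∀ n ∈ s, constantCoeff (u n) = 1 := fun n hn => h n (Finset.mem_cons_of_mem hn)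
    rw [Finset.prod_cons, Finset.sum_cons, logDer_mul (h a (Finset.mem_cons_self a s)), ih h']
    rw [map_prod]
    exact Finset.prod_eq_one h'

theorem logDer_congr {f g : A⟦X⟧} (hf : constantCoeff f = 1) (hg : constantCoeff g = 1) {k : ℕ}
    (h : X ^ (k + 1) ∣ f - g) : coeff k (logDer f) = coeff k (logDer g) := by
  obtain ⟨r, hr⟩ := h
  have e : logDer f - logDer g =
      X ^ (k + 1) * ((((k + 1 : ℕ) : A⟦X⟧) * r + X * d⁄dX A r) * inv1 f
        - r * logDer g * inv1 f) := by
    have hd : d⁄dX A f = d⁄dX A g + (((k + 1 : ℕ) : A⟦X⟧) * X ^ k * r + X ^ (k + 1) * d⁄dX A r) := by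
      have : f = g + X ^ (k + 1) * r := by rw [← hr]; ring
      rw [this, map_add, Derivation.leibniz, derivative_pow, derivative_X, smul_eq_mul,
        smul_eq_mul, Nat.add_sub_cancel]
      ring
    have h1 := mul_inv1 hf
    have h2 := mul_inv1 hg
    have h3 : r * X ^ (k + 1) = f - g := by rw [hr]; ring
    rw [logDer, logDer, hd]
    rw [pow_succ] at h3 ⊢
    linear_combination (X * d⁄dX A g * inv1 g * inv1 f) * h3
      + (X * d⁄dX A g * inv1 g) * h1 - (X * d⁄dX A g * inv1 f) * h2
  rw [← sub_eq_zero, ← map_sub, e]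
  exact X_pow_dvd_iff.1 (Dvd.intro _ rfl) k (by omega)

theorem coeff_logDer_infProd (u : ℕ → A⟦X⟧) (h : ∀ n, 1 ≤ n → X ^ n ∣ u n - 1) (k : ℕ) :
    coeff k (logDer (infProd u)) = ∑ n ∈ Finset.Icc 1 k, coeff k (logDer (u n)) := by
  have hc : ∀ n ∈ Finset.Icc 1 k, constantCoeff (u n) = 1 := fun n hn =>
    const_of_dvd (Finset.mem_Icc.1 hn).1 (h n (Finset.mem_Icc.1 hn).1)
  rw [logDer_congr (const_infProd u) _ (infProd_approx u h k), logDer_prod _ _ hc, map_sum]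
  rw [map_prod]
  exact Finset.prod_eq_one hc

theorem logDer_injective [IsDomain A] [CharZero A] {f g : A⟦X⟧} (hf : constantCoeff f = 1)
    (hg : constantCoeff g = 1) (h : ∀ k, 1 ≤ k → coeff k (logDer f) = coeff k (logDer g)) :
    f = g := by
  have h0 : logDer f = logDer g := by
    ext k
    rcases Nat.eq_zero_or_pos k with rfl | hk
    · simp [logDer, mul_assoc]
    · exact h k hk
  have h1 : logDer (f * inv1 g) = 0 := by
    rw [logDer_mul hf (const_inv1 g), logDer_inv1 hg, h0, add_neg_cancel]
  have hc : constantCoeff (f * inv1 g) = 1 := by simp [hf, const_inv1]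
  have h2 : d⁄dX A (f * inv1 g) = 0 := by
    have h3 : X * d⁄dX A (f * inv1 g) = 0 := by
      calc X * d⁄dX A (f * inv1 g) = logDer (f * inv1 g) * (f * inv1 g) := by
            rw [logDer]; linear_combination (-X * d⁄dX A (f * inv1 g)) * mul_inv1 hc
        _ = 0 := by rw [h1, zero_mul]
    exact (mul_eq_zero.1 h3).resolve_left X_ne_zero
  have h4 : f * inv1 g = 1 := derivative.ext (by rw [h2, derivative_one]) (by simpa using hc)
  calc f = f * (g * inv1 g) := by rw [mul_inv1 hg, mul_one]
    _ = (f * inv1 g) * g := by ring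
    _ = g := by rw [h4, one_mul]

theorem coeff_logDer_factor (a : A) {n : ℕ} (hn : 1 ≤ n) {k : ℕ} (hk : 1 ≤ k) :
    coeff k (logDer (factor a n)) = if n ∣ k then -(n * a ^ (k / n)) else 0 := by
  have hc : constantCoeff (factor a n) = 1 := const_of_dvd hn (factor_dvd a le_rfl)
  have e : inv1 (factor a n) = PowerSeries.mk fun j => if n ∣ j then a ^ (j / n) else 0 := by
    refine inv1_eq hc ?_
    ext j
    rw [factor, sub_mul, one_mul, mul_assoc, map_sub, coeff_C_mul, coeff_X_pow_mul', coeff_mk,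
      coeff_one]
    by_cases hj : n ≤ j
    · rw [if_pos hj, coeff_mk, if_neg (by omega : j ≠ 0)]
      by_cases hd : n ∣ j
      · obtain ⟨c, rfl⟩ := hd
        obtain ⟨c, rfl⟩ : ∃ c', c = c' + 1 := ⟨c - 1, by
          have : c ≠ 0 := by rintro rfl; omega
          omega⟩
        have : n * (c + 1) - n = n * c := by rw [mul_add, mul_one, Nat.add_sub_cancel]
        rw [this, if_pos (Dvd.intro _ rfl), if_pos (Dvd.intro _ rfl),
          Nat.mul_div_cancel_left _ hn, Nat.mul_div_cancel_left _ hn, pow_succ]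
        ring
      · rw [if_neg hd, if_neg (fun h => hd ((Nat.dvd_sub_iff_left hj dvd_rfl).1 h))]
        ring
    · rw [if_neg hj]
      rcases Nat.eq_zero_or_pos j with rfl | hj0
      · simp
      · rw [if_neg (fun h => hj (Nat.le_of_dvd hj0 h)), if_neg (by omega : j ≠ 0)]
        ring
  have hd : X * d⁄dX A (factor a n) = -(C ((n : A) * a) * X ^ n) := by
    obtain ⟨m, rfl⟩ : ∃ m, n = m + 1 := ⟨n - 1, by omega⟩
    simp only [factor, map_sub, Derivation.leibniz, derivative_C, derivative_pow, derivative_X,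
      smul_eq_mul, derivative_one, Nat.add_sub_cancel, map_mul, map_natCast]
    ring
  rw [logDer, hd, e, neg_mul, map_neg, mul_assoc, coeff_C_mul, coeff_X_pow_mul']
  by_cases hj : n ≤ k
  · rw [if_pos hj, coeff_mk]
    by_cases hd : n ∣ k
    · obtain ⟨c, rfl⟩ := hd
      obtain ⟨c, rfl⟩ : ∃ c', c = c' + 1 := ⟨c - 1, by
        have : c ≠ 0 := by rintro rfl; omega
        omega⟩
      have : n * (c + 1) - n = n * c := by rw [mul_add, mul_one, Nat.add_sub_cancel]
      rw [this, if_pos (Dvd.intro _ rfl), if_pos (Dvd.intro _ rfl),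
        Nat.mul_div_cancel_left _ hn, Nat.mul_div_cancel_left _ hn, pow_succ]
      ring
    · rw [if_neg hd, if_neg (fun h => hd ((Nat.dvd_sub_iff_left hj dvd_rfl).1 h))]
      ring
  · rw [if_neg hj, if_neg (fun h => hj (Nat.le_of_dvd hk h))]
    ring

/-- The ghost components of `Λ^q`: `X f' / f = q ∑ Φ_k X^k`. -/
theorem coeff_logDer_eq [Invertible (q : A)] {f : A⟦X⟧} (hf : constantCoeff f = 1) {k : ℕ}
    (hk : 1 ≤ k) : coeff k (logDer f) =
      q * ∑ m ∈ Finset.Icc 1 k, if m ∣ k then (m : A) * coord q f m ^ (k / m) else 0 := by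
  have h := logDer_inv1 (const_inv1 f)
  rw [inv1_inv1 hf] at h
  rw [h, ← infProd_coord (q := q), map_neg, coeff_logDer_infProd _
    (fun n hn => pow_dvd_sub_one (factor_dvd _ le_rfl)), Finset.mul_sum, ← Finset.sum_neg_distrib]
  refine Finset.sum_congr rfl fun m hm => ?_
  have hm1 := (Finset.mem_Icc.1 hm).1
  rw [logDer_pow (const_of_dvd hm1 (factor_dvd _ le_rfl)), ← map_natCast (C (R := A)),
    coeff_C_mul, coeff_logDer_factor _ hm1 hk]
  split_ifs <;> ring

theorem starProd_dvd (a b : ℕ → A) (m : ℕ) : ∀ n, 1 ≤ n → X ^ m ∣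
    factor (a m ^ (n / m.gcd n) * b n ^ (m / m.gcd n)) (m.lcm n) ^ (q * m.gcd n) - 1 := by
  intro n hn
  refine pow_dvd_sub_one (factor_dvd _ ?_)
  rcases Nat.eq_zero_or_pos m with rfl | hm
  · simp
  · exact Nat.le_of_dvd (Nat.lcm_pos hm hn) (Nat.dvd_lcm_left m n)

theorem starProd_dvd' (a b : ℕ → A) {m : ℕ} (hm : 1 ≤ m) : ∀ n, 1 ≤ n → X ^ n ∣
    factor (a m ^ (n / m.gcd n) * b n ^ (m / m.gcd n)) (m.lcm n) ^ (q * m.gcd n) - 1 :=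
  fun n hn => pow_dvd_sub_one (factor_dvd _ (Nat.le_of_dvd (Nat.lcm_pos hm hn)
    (Nat.dvd_lcm_right m n)))

theorem const_starProd (a b : ℕ → A) : constantCoeff (starProd q a b) = 1 := const_infProd _

theorem coeff_logDer_starProd (a b : ℕ → A) {k : ℕ} (hk : 1 ≤ k) :
    coeff k (logDer (starProd q a b)) =
      -(q * ((∑ m ∈ Finset.Icc 1 k, if m ∣ k then (m : A) * a m ^ (k / m) else 0) *
        ∑ n ∈ Finset.Icc 1 k, if n ∣ k then (n : A) * b n ^ (k / n) else 0)) := by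
  rw [starProd, coeff_logDer_infProd _ (fun m hm => infProd_dvd_sub_one _ (starProd_dvd a b m)),
    Finset.sum_mul_sum, Finset.mul_sum, ← Finset.sum_neg_distrib]
  refine Finset.sum_congr rfl fun m hm => ?_
  have hm1 := (Finset.mem_Icc.1 hm).1
  rw [coeff_logDer_infProd _ (starProd_dvd' a b hm1), Finset.mul_sum, ← Finset.sum_neg_distrib]
  refine Finset.sum_congr rfl fun n hn => ?_
  have hn1 := (Finset.mem_Icc.1 hn).1
  have hl : 1 ≤ m.lcm n := Nat.lcm_pos hm1 hn1
  rw [logDer_pow (const_of_dvd hl (factor_dvd _ le_rfl)), ← map_natCast (C (R := A)),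
    coeff_C_mul, coeff_logDer_factor _ hl hk]
  by_cases h1 : m ∣ k
  · by_cases h2 : n ∣ k
    · rw [if_pos h1, if_pos h2, if_pos (Nat.lcm_dvd h1 h2)]
      obtain ⟨j, hj⟩ := Nat.lcm_dvd h1 h2
      have e0 : ((m.gcd n : ℕ) : A) * (m.lcm n : ℕ) = m * n := by
        exact_mod_cast congrArg (Nat.cast (R := A)) (Nat.gcd_mul_lcm m n)
      have hg : 0 < m.gcd n := Nat.gcd_pos_of_pos_left n hm1
      have e1 : k / m.lcm n = j := by rw [hj, Nat.mul_div_cancel_left _ hl]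
      have e2 : k / m = n / m.gcd n * j := by
        rw [hj, Nat.lcm, Nat.mul_div_assoc _ (Nat.gcd_dvd_right m n), mul_assoc,
          Nat.mul_div_cancel_left _ hm1]
      have e3 : k / n = m / m.gcd n * j := by
        rw [hj, Nat.lcm_comm, Nat.lcm, Nat.gcd_comm n m,
          Nat.mul_div_assoc _ (Nat.gcd_dvd_left m n), mul_assoc, Nat.mul_div_cancel_left _ hn1]
      rw [e1, e2, e3, mul_pow, ← pow_mul, ← pow_mul]
      push_cast
      linear_combination (-(q : A) * a m ^ (n / m.gcd n * j) * b n ^ (m / m.gcd n * j)) * e0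
    · rw [if_neg h2, if_neg (fun h => h2 ((Nat.dvd_lcm_right m n).trans h))]
      ring
  · rw [if_neg h1, if_neg (fun h => h1 ((Nat.dvd_lcm_left m n).trans h))]
    ring

namespace LambdaQ

/-- The ghost components multiply under `⋆_q`. -/
theorem logDer_mul_val [Invertible (q : A)] (f g : LambdaQ q A) {k : ℕ} (hk : 1 ≤ k) :
    coeff k (logDer (f * g).val) =
      ⅟(q : A) * (coeff k (logDer f.val) * coeff k (logDer g.val)) := by
  rw [val_mul, logDer_inv1 (const_starProd _ _), map_neg, coeff_logDer_starProd _ _ hk,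
    coeff_logDer_eq (q := q) f.const hk, coeff_logDer_eq (q := q) g.const hk, neg_neg,
    mul_assoc (q : A), invOf_mul_cancel_left']
  ring

theorem logDer_add_val (f g : LambdaQ q A) (k : ℕ) :
    coeff k (logDer (f + g).val) = coeff k (logDer f.val) + coeff k (logDer g.val) := by
  rw [val_add, logDer_mul f.const g.const, map_add]

theorem const_factor (a : A) : constantCoeff (factor a 1) = 1 := by
  simp [factor]

theorem logDer_geom (a : A) {k : ℕ} (hk : 1 ≤ k) :
    coeff k (logDer (inv1 (factor a 1 ^ q))) = q * a ^ k := by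
  rw [logDer_inv1 (by simp [const_factor]), logDer_pow (const_factor a),
    ← map_natCast (C (R := A)), map_neg, coeff_C_mul, coeff_logDer_factor _ le_rfl hk]
  simp

theorem ext_logDer [IsDomain A] [CharZero A] {f g : LambdaQ q A}
    (h : ∀ k, 1 ≤ k → coeff k (logDer f.val) = coeff k (logDer g.val)) : f = g :=
  LambdaQ.ext (logDer_injective f.const g.const h)

/-- The action of a ring homomorphism on coefficients. -/
noncomputable def mapFun (φ : A →+* B) (f : LambdaQ q A) : LambdaQ q B :=
  ⟨PowerSeries.map φ f.val, by
    rw [← coeff_zero_eq_constantCoeff_apply, coeff_map, coeff_zero_eq_constantCoeff_apply,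
      f.const, map_one]⟩

theorem mapFun_add (φ : A →+* B) (f g : LambdaQ q A) :
    mapFun φ (f + g) = mapFun φ f + mapFun φ g := LambdaQ.ext (map_mul _ _ _)

theorem mapFun_zero (φ : A →+* B) : mapFun φ (0 : LambdaQ q A) = 0 := LambdaQ.ext (map_one _)

theorem mapFun_geom (φ : A →+* B) (a : A) :
    mapFun φ (⟨inv1 (factor a 1 ^ q), const_inv1 _⟩ : LambdaQ q A) =
      ⟨inv1 (factor (φ a) 1 ^ q), const_inv1 _⟩ := by
  refine LambdaQ.ext ?_
  change PowerSeries.map φ (inv1 (factor a 1 ^ q)) = _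
  rw [map_inv1 φ (by simp [const_factor]), map_pow, map_factor]

theorem mapFun_one (φ : A →+* B) : mapFun φ (1 : LambdaQ q A) = 1 := by
  refine (mapFun_geom φ 1).trans (LambdaQ.ext ?_)
  change inv1 (factor (φ 1) 1 ^ q) = inv1 (factor 1 1 ^ q)
  rw [map_one]

theorem mapFun_mul (φ : A →+* B) [Invertible (q : A)] [Invertible (q : B)] (f g : LambdaQ q A) :
    mapFun φ (f * g) = mapFun φ f * mapFun φ g := by
  refine LambdaQ.ext ?_
  change PowerSeries.map φ (f * g).val = (mapFun φ f * mapFun φ g).val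
  rw [val_mul, val_mul, map_inv1 φ (const_starProd _ _), starProd, map_infProd]
  simp only [map_infProd, map_pow, map_factor, map_mul, map_coord φ f.const, map_coord φ g.const]
  rfl

theorem mapFun_surjective {φ : A →+* B} (h : Function.Surjective φ) :
    Function.Surjective (mapFun (q := q) φ) := by
  intro f
  choose s hs using h
  refine ⟨⟨PowerSeries.mk fun n => if n = 0 then 1 else s (coeff n f.val), ?_⟩, ?_⟩
  · rw [← coeff_zero_eq_constantCoeff_apply, coeff_mk, if_pos rfl]
  · refine LambdaQ.ext (PowerSeries.ext fun n => ?_)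
    rw [mapFun, coeff_map, coeff_mk]
    split_ifs with hn
    · rw [hn, map_one, coeff_zero_eq_constantCoeff_apply, f.const]
    · exact hs _

/-- A ring in which `q` is invertible is a quotient of a domain of characteristic zero
in which `q` is invertible. -/
theorem exists_cover (q : ℕ) [NeZero q] (A : Type u) [CommRing A] [Invertible (q : A)] :
    ∃ (R : Type u) (_ : CommRing R) (_ : IsDomain R) (_ : CharZero R) (_ : Invertible (q : R))
      (φ : R →+* A), Function.Surjective φ := by
  let P := MvPolynomial A ℤ
  have hq : (q : P) ≠ 0 := NeZero.ne _
  have hle : Submonoid.powers (q : P) ≤ nonZeroDivisors P :=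
    powers_le_nonZeroDivisors_of_noZeroDivisors hq
  have hinj : Function.Injective (algebraMap P (Localization.Away (q : P))) :=
    IsLocalization.injective _ hle
  have hu : IsUnit (QWitt.polyMap A (q : P)) := by
    rw [map_natCast]; exact isUnit_of_invertible _
  have hu' : IsUnit ((q : ℕ) : Localization.Away (q : P)) := by
    have := IsLocalization.Away.algebraMap_isUnit (S := Localization.Away (q : P)) (q : P)
    rwa [map_natCast] at this
  refine ⟨Localization.Away (q : P), inferInstance,
    IsLocalization.isDomain_of_le_nonZeroDivisors _ hle, charZero_of_injective_algebraMap hinj,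
    hu'.invertible, IsLocalization.Away.lift (q : P) hu, fun a => ?_⟩
  refine ⟨algebraMap P _ (MvPolynomial.X a), ?_⟩
  rw [IsLocalization.Away.lift_eq]
  exact MvPolynomial.eval₂_X _ _ _

/-- `Λ^q(A)` as a commutative ring, for `q` invertible in `A`. -/
noncomputable instance instCommRing [NeZero q] [Invertible (q : A)] : CommRing (LambdaQ q A) where
  nsmul := nsmulRec
  zsmul := zsmulRec
  add_assoc f g h := LambdaQ.ext (mul_assoc _ _ _)
  zero_add f := LambdaQ.ext (one_mul _)
  add_zero f := LambdaQ.ext (mul_one _)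
  add_comm f g := LambdaQ.ext (mul_comm _ _)
  neg_add_cancel f := LambdaQ.ext (by
    change inv1 f.val * f.val = 1
    rw [mul_comm, mul_inv1 f.const])
  mul_assoc f g h := by
    obtain ⟨R, _, _, _, _, φ, hφ⟩ := exists_cover q A
    obtain ⟨f, rfl⟩ := mapFun_surjective hφ f
    obtain ⟨g, rfl⟩ := mapFun_surjective hφ g
    obtain ⟨h, rfl⟩ := mapFun_surjective hφ h
    simp only [← mapFun_mul]
    refine congrArg _ (ext_logDer fun k hk => ?_)
    simp only [logDer_mul_val _ _ hk]
    ring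
  left_distrib f g h := by
    obtain ⟨R, _, _, _, _, φ, hφ⟩ := exists_cover q A
    obtain ⟨f, rfl⟩ := mapFun_surjective hφ f
    obtain ⟨g, rfl⟩ := mapFun_surjective hφ g
    obtain ⟨h, rfl⟩ := mapFun_surjective hφ h
    simp only [← mapFun_mul, ← mapFun_add]
    refine congrArg _ (ext_logDer fun k hk => ?_)
    simp only [logDer_mul_val _ _ hk, logDer_add_val]
    ring
  right_distrib f g h := by
    obtain ⟨R, _, _, _, _, φ, hφ⟩ := exists_cover q A
    obtain ⟨f, rfl⟩ := mapFun_surjective hφ f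
    obtain ⟨g, rfl⟩ := mapFun_surjective hφ g
    obtain ⟨h, rfl⟩ := mapFun_surjective hφ h
    simp only [← mapFun_mul, ← mapFun_add]
    refine congrArg _ (ext_logDer fun k hk => ?_)
    simp only [logDer_mul_val _ _ hk, logDer_add_val]
    ring
  mul_comm f g := by
    obtain ⟨R, _, _, _, _, φ, hφ⟩ := exists_cover q A
    obtain ⟨f, rfl⟩ := mapFun_surjective hφ f
    obtain ⟨g, rfl⟩ := mapFun_surjective hφ g
    simp only [← mapFun_mul]
    refine congrArg _ (ext_logDer fun k hk => ?_)
    simp only [logDer_mul_val _ _ hk]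
    ring
  one_mul f := by
    obtain ⟨R, _, _, _, _, φ, hφ⟩ := exists_cover q A
    obtain ⟨f, rfl⟩ := mapFun_surjective hφ f
    simp only [← mapFun_mul, ← mapFun_one φ]
    refine congrArg _ (ext_logDer fun k hk => ?_)
    rw [logDer_mul_val _ _ hk, val_one, logDer_geom _ hk, one_pow, mul_one]
    linear_combination coeff k (logDer f.val) * invOf_mul_self (q : R)
  mul_one f := by
    obtain ⟨R, _, _, _, _, φ, hφ⟩ := exists_cover q A
    obtain ⟨f, rfl⟩ := mapFun_surjective hφ f
    simp only [← mapFun_mul, ← mapFun_one φ]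
    refine congrArg _ (ext_logDer fun k hk => ?_)
    rw [logDer_mul_val _ _ hk, val_one, logDer_geom _ hk, one_pow, mul_one]
    linear_combination coeff k (logDer f.val) * invOf_mul_self (q : R)
  zero_mul f := by
    obtain ⟨R, _, _, _, _, φ, hφ⟩ := exists_cover q A
    obtain ⟨f, rfl⟩ := mapFun_surjective hφ f
    simp only [← mapFun_mul, ← mapFun_zero φ]
    refine congrArg _ (ext_logDer fun k hk => ?_)
    rw [logDer_mul_val _ _ hk, val_zero, logDer_one, map_zero]
    ring
  mul_zero f := by
    obtain ⟨R, _, _, _, _, φ, hφ⟩ := exists_cover q A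
    obtain ⟨f, rfl⟩ := mapFun_surjective hφ f
    simp only [← mapFun_mul, ← mapFun_zero φ]
    refine congrArg _ (ext_logDer fun k hk => ?_)
    rw [logDer_mul_val _ _ hk, val_zero, logDer_one, map_zero]
    ring

/-- The defining property `(1 - aX)^{-q} ⋆_q (1 - bX)^{-q} = (1 - abX)^{-q}`. -/
theorem geom_mul_geom [NeZero q] [Invertible (q : A)] (a b : A) :
    (⟨inv1 (factor a 1 ^ q), const_inv1 _⟩ * ⟨inv1 (factor b 1 ^ q), const_inv1 _⟩ :
      LambdaQ q A) = ⟨inv1 (factor (a * b) 1 ^ q), const_inv1 _⟩ := by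
  obtain ⟨R, _, _, _, _, φ, hφ⟩ := exists_cover q A
  obtain ⟨a, rfl⟩ := hφ a
  obtain ⟨b, rfl⟩ := hφ b
  rw [← map_mul, ← mapFun_geom, ← mapFun_geom, ← mapFun_geom, ← mapFun_mul]
  refine congrArg _ (ext_logDer fun k hk => ?_)
  rw [logDer_mul_val _ _ hk, logDer_geom _ hk, logDer_geom _ hk, logDer_geom _ hk, mul_pow]
  linear_combination ((q : R) * a ^ k * b ^ k) * invOf_mul_self (q : R)

/-- Functoriality of `Λ^q`. -/
noncomputable def map [NeZero q] [Invertible (q : A)] [Invertible (q : B)] (φ : A →+* B) :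
    LambdaQ q A →+* LambdaQ q B where
  toFun := mapFun φ
  map_zero' := LambdaQ.ext (map_one _)
  map_one' := mapFun_one φ
  map_add' := mapFun_add φ
  map_mul' := mapFun_mul φ

end LambdaQ

end LambdaQ

/-- The `q`-analogue of the Artin--Hasse map `W^q(A) → Λ^q(A)`,
`(x_n) ↦ ∏_{n ≥ 1} (1 - q x_n X^n)^{-1}`; the logarithmic derivative `X d/dX log` of the image
of `x` is `∑_{n ≥ 1} q Φ^q_n(x) X^n`. -/
noncomputable def artinHasse {q : ℕ} {A : Type u} [CommRing A] (x : QWitt q A) : LambdaQ q A :=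
  ⟨inv1 (infProd fun n => factor ((q : A) * x.comp n.toPNat') n), const_inv1 _⟩

end WittQ

/-! The homomorphism. The logarithmic derivative turns determinants into traces: `X d/dX log` of
`det(1 - XM)^(-q)` is `q ∑ tr(M^k) X^k`. Short exact sequences of pairs give block triangular
matrices, so determinants multiply and `L^q` is additive. Tensor products give Kronecker products,
with `tr((M ⊗ N)^k) = tr(M^k) tr(N^k)`, and `⋆_q` multiplies logarithmic derivatives coefficientwise
up to the factor `1/q`, so `L^q` is multiplicative (`LambdaQ.ofMatrix_mul`). Traces determine the
series only without torsion. Identities of this kind are therefore proved over a domain of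
characteristic zero that surjects onto `A` and in which `q` is invertible.

Injectivity. Since `q` is invertible, `q`-th roots with constant term `1` are unique
(`eq_of_pow_eq_pow`). It remains to see that `det(1 - tM(f))` determines `[E, f]` in `W₀(A)`, which
is Almkvist's theorem. A pair is an `A[X]`-module that is finitely generated projective over `A`. Up
to a pair with zero endomorphism it is `(Aⁿ, M)`, the cokernel of `X - M` on `A[X]ⁿ`. Elimination
with exact sequences of cokernels shows that the class of such a cokernel is that of `A[X]/(det)`
(`detDeterminesClass`), so `[Aⁿ, M]` depends only on the characteristic polynomial (`mk_ofMatrix`).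
The reverse characteristic polynomial recovers it up to powers of `X`. These are harmless:
`A[X]/(X^m)` is filtered by modules on which `X` acts as zero, so its class vanishes.

Image. Every class is a difference `[E] - [F]`, and every polynomial `P` with constant term `1` is
the determinant of a companion pair, namely multiplication by the root on `A[X]/(reverse of P)`.

The copy in `W^q(A)`. For invertible `q` the Artin–Hasse map is an isomorphism of rings
(`artinHasseEquiv`), because it takes ghost components to logarithmic derivatives and the
factorization into `1 - a_n X^n` is unique. Then `φ` is `L^q` followed by its inverse. -/

namespace WittQ

/-! ### Logarithmic derivatives of determinants, and traces. -/

section Determinants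

open PowerSeries

/-- The Leibniz rule for a finite product. -/
theorem derivation_prod {R S ι : Type*} [CommRing R] [CommRing S] [Algebra R S] [DecidableEq ι]
    (D : Derivation R S S) (s : Finset ι) (f : ι → S) :
    D (∏ i ∈ s, f i) = ∑ i ∈ s, ∏ j ∈ s, Function.update f i (D (f i)) j := by
  induction s using Finset.induction_on with
  | empty => simp
  | insert a s ha ih =>
    rw [Finset.prod_insert ha, Derivation.leibniz, ih, Finset.sum_insert ha,
      Finset.prod_insert ha, Function.update_self, smul_eq_mul, smul_eq_mul, add_comm,
      Finset.mul_sum]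
    congr 1
    · rw [mul_comm]
      congr 1
      refine Finset.prod_congr rfl fun j hj => ?_
      rw [Function.update_of_ne (by rintro rfl; exact ha hj)]
    · refine Finset.sum_congr rfl fun i hi => ?_
      rw [Finset.prod_insert ha, Function.update_of_ne (by rintro rfl; exact ha hi)]

/-- Jacobi's formula: the derivative of a determinant. -/
theorem derivation_det {R S n : Type*} [CommRing R] [CommRing S] [Algebra R S] [Fintype n]
    [DecidableEq n] (D : Derivation R S S) (N : Matrix n n S) :
    D N.det = (N.adjugate * N.map D).trace := by
  -- Cramer's rule: the diagonal entries are the determinants with one column differentiated, and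
  -- their sum is the Leibniz rule applied to the expansion of `N.det`.
  have h : ∀ i, (N.adjugate * N.map D) i i = (N.updateCol i fun j => D (N j i)).det := by
    intro i
    rw [← Matrix.cramer_apply, Matrix.cramer_eq_adjugate_mulVec]
    rfl
  simp only [Matrix.trace, Matrix.diag, h, Matrix.det_apply, map_sum]
  rw [Finset.sum_comm]
  refine Finset.sum_congr rfl fun σ _ => ?_
  rw [← Finset.smul_sum, Units.smul_def, map_zsmul, derivation_prod]
  rw [Units.smul_def]
  congr 1
  refine Finset.sum_congr rfl fun i _ => Finset.prod_congr rfl fun j _ => ?_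
  rcases eq_or_ne j i with rfl | h
  · simp
  · rw [Function.update_of_ne h, Matrix.updateCol_ne h]

variable {A B : Type*} [CommRing A] [CommRing B] {q : ℕ}
variable {m n : Type*} [Fintype m] [Fintype n] [DecidableEq m] [DecidableEq n]

theorem coe_charpolyRev (M : Matrix n n A) :
    (M.charpolyRev : A⟦X⟧) = (1 - (X : A⟦X⟧) • M.map C).det := by
  rw [Matrix.charpolyRev, ← Polynomial.coeToPowerSeries.ringHom_apply, RingHom.map_det]
  congr 1
  ext i j k
  by_cases h : i = j <;> simp [h] <;> exact mul_comm _ _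

theorem const_charpolyRev (M : Matrix n n A) :
    constantCoeff (M.charpolyRev : A⟦X⟧) = 1 := by
  rw [Polynomial.constantCoeff_coe, Polynomial.coeff_zero_eq_eval_zero, Matrix.eval_charpolyRev]

/-- The logarithmic derivative of `det (1 - X M)` is `-∑ tr(M ^ k) X ^ k`. -/
theorem coeff_logDer_charpolyRev (M : Matrix n n A) {k : ℕ} (hk : 1 ≤ k) :
    coeff k (logDer (M.charpolyRev : A⟦X⟧)) = -(M ^ k).trace := by
  have hc := const_charpolyRev M
  rw [coe_charpolyRev] at hc ⊢
  set N : Matrix n n A⟦X⟧ := 1 - (X : A⟦X⟧) • M.map C with hN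
  -- The geometric series `∑ M^k X^k` is the inverse of `1 - XM`, so the adjugate in Jacobi's
  -- formula is `det • G`, and dividing by the determinant leaves a trace.
  let G : Matrix n n A⟦X⟧ := .of fun i j => PowerSeries.mk fun k => (M ^ k) i j
  have hMG : ∀ i j k, coeff k ((G * M.map C) i j) = (M ^ (k + 1)) i j := by
    intro i j k
    rw [Matrix.mul_apply, map_sum, pow_succ, Matrix.mul_apply]
    refine Finset.sum_congr rfl fun l _ => ?_
    simp [G, coeff_mul_C]
  have hGN : G * N = 1 := by
    rw [hN, mul_sub, mul_one, Matrix.mul_smul]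
    ext i j k
    rw [Matrix.sub_apply, Matrix.smul_apply, smul_eq_mul, map_sub]
    rcases k with _ | k
    · by_cases h : i = j <;> simp [G, Matrix.one_apply, h]
    · rw [coeff_succ_X_mul, hMG]
      by_cases h : i = j <;> simp [G, Matrix.one_apply, h, coeff_one]
  have hadj : N.adjugate = N.det • G := by
    calc N.adjugate = G * N * N.adjugate := by rw [hGN, one_mul]
      _ = N.det • G := by rw [mul_assoc, Matrix.mul_adjugate, Matrix.mul_smul, mul_one]
  have hD : N.map (d⁄dX A) = -(M.map C) := by
    ext1 i j
    have : N i j = C ((1 : Matrix n n A) i j) - C (M i j) * X := by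
      by_cases h : i = j <;> simp [hN, Matrix.one_apply, h, X_mul]
    rw [Matrix.map_apply, this]
    simp [-map_mul, -map_one]
  have e : logDer N.det = -(X * (G * M.map C).trace) := by
    rw [logDer, derivation_det, hD, hadj, mul_neg, Matrix.trace_neg, Matrix.smul_mul,
      Matrix.trace_smul, smul_eq_mul]
    linear_combination (-X * (G * M.map C).trace) * mul_inv1 hc
  obtain ⟨k, rfl⟩ : ∃ j, k = j + 1 := ⟨k - 1, by omega⟩
  rw [e, map_neg, coeff_succ_X_mul, Matrix.trace, Matrix.trace, map_sum]
  simp only [Matrix.diag, hMG]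

/-- The element `det (1 - X M) ^ (-q)` of `Λ^q`. -/
noncomputable def LambdaQ.ofMatrix (q : ℕ) (M : Matrix n n A) : LambdaQ q A :=
  ⟨inv1 ((M.charpolyRev : A⟦X⟧) ^ q), const_inv1 _⟩

theorem map_charpolyRev (φ : A →+* B) (M : Matrix n n A) :
    PowerSeries.map φ (M.charpolyRev : A⟦X⟧) = ((M.map φ).charpolyRev : B⟦X⟧) := by
  rw [coe_charpolyRev, coe_charpolyRev, RingHom.map_det]
  congr 1
  ext1 i j
  by_cases h : i = j <;> simp [h]

theorem const_charpolyRev_pow (M : Matrix n n A) :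
    constantCoeff ((M.charpolyRev : A⟦X⟧) ^ q) = 1 := by
  rw [map_pow, const_charpolyRev, one_pow]

theorem LambdaQ.mapFun_ofMatrix (φ : A →+* B) (M : Matrix n n A) :
    mapFun φ (ofMatrix q M) = ofMatrix q (M.map φ) := by
  refine LambdaQ.ext ?_
  change PowerSeries.map φ (inv1 _) = inv1 _
  rw [map_inv1 φ (const_charpolyRev_pow M), map_pow, map_charpolyRev]

theorem LambdaQ.logDer_ofMatrix (M : Matrix n n A) {k : ℕ} (hk : 1 ≤ k) :
    coeff k (logDer (ofMatrix q M).val) = q * (M ^ k).trace := by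
  change coeff k (logDer (inv1 _)) = _
  rw [logDer_inv1 (const_charpolyRev_pow M), logDer_pow (const_charpolyRev M),
    ← map_natCast (C (R := A)), map_neg, coeff_C_mul, coeff_logDer_charpolyRev _ hk]
  ring

theorem kronecker_pow (M : Matrix m m A) (N : Matrix n n A) (k : ℕ) :
    (Matrix.kronecker M N) ^ k = Matrix.kronecker (M ^ k) (N ^ k) := by
  induction k with
  | zero => simp [Matrix.kronecker]
  | succ k ih => rw [pow_succ, ih, pow_succ, pow_succ, Matrix.kronecker, Matrix.mul_kronecker_mul]

/-- The trace of a Kronecker power is the product of the traces, and the factor `1/q` in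
`logDer_mul_val` cancels one of the two factors `q`. Comparing logarithmic derivatives suffices only
over a domain of characteristic zero, hence the lift of both matrices to `R`. -/
theorem LambdaQ.ofMatrix_mul {A : Type u} [CommRing A] [NeZero q] [Invertible (q : A)]
    (M : Matrix m m A) (N : Matrix n n A) :
    ofMatrix q M * ofMatrix q N = ofMatrix q (Matrix.kronecker M N) := by
  obtain ⟨R, _, _, _, _, φ, hφ⟩ := exists_cover q A
  obtain ⟨s, hs⟩ := hφ.hasRightInverse
  obtain ⟨M, rfl⟩ : ∃ M' : Matrix m m R, M'.map φ = M := ⟨M.map s, by ext i j; simp [hs _]⟩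
  obtain ⟨N, rfl⟩ : ∃ N' : Matrix n n R, N'.map φ = N := ⟨N.map s, by ext i j; simp [hs _]⟩
  have hk : Matrix.kronecker (M.map φ) (N.map φ) = (Matrix.kronecker M N).map φ := by
    ext ⟨i, j⟩ ⟨i', j'⟩; simp
  rw [hk, ← mapFun_ofMatrix]
  rw [← mapFun_ofMatrix, ← mapFun_ofMatrix, ← mapFun_mul]
  refine congrArg _ (ext_logDer fun k hk => ?_)
  rw [logDer_mul_val _ _ hk, logDer_ofMatrix _ hk, logDer_ofMatrix _ hk, logDer_ofMatrix _ hk,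
    kronecker_pow, Matrix.kronecker, Matrix.trace_kronecker]
  linear_combination ((q : R) * (M ^ k).trace * (N ^ k).trace) * invOf_mul_self (q : R)

/-- Uniqueness of `q`-th roots among the power series with constant term `1`. -/
theorem eq_of_pow_eq_pow [Invertible (q : A)] {f g : A⟦X⟧} (hf : constantCoeff f = 1)
    (hg : constantCoeff g = 1) (h : f ^ q = g ^ q) : f = g := by
  have e := (Commute.all f g).mul_geom_sum₂ q
  rw [h, sub_self] at e
  -- The cofactor of `f - g` in `f^q - g^q` has constant term `q`, a unit.
  have hu : IsUnit (∑ i ∈ Finset.range q, f ^ i * g ^ (q - 1 - i)) := by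
    rw [isUnit_iff_constantCoeff]
    simp only [map_sum, map_mul, map_pow, hf, hg, one_pow, mul_one, Finset.sum_const,
      Finset.card_range, nsmul_eq_mul]
    exact isUnit_of_invertible _
  exact sub_eq_zero.1 ((hu.mul_left_eq_zero).1 e)

end Determinants

/-! ### The characteristic determinant of a pair and the homomorphism `L^q`. -/

section CharDet

open PowerSeries

variable {A : Type u} [CommRing A] {q : ℕ}

namespace EndObj

theorem exists_presentation (E : EndObj A) : ∃ (n : ℕ) (p : (Fin n → A) →ₗ[A] E.carrier)
    (s : E.carrier →ₗ[A] (Fin n → A)), p ∘ₗ s = .id := by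
  obtain ⟨n, p, s, -, -, h⟩ := Module.Finite.exists_comp_eq_id_of_projective A E.carrier
  exact ⟨n, p, s, h⟩

theorem Iso.charDet_eq {E F : EndObj A} (h : Iso E F) : E.charDet = F.charDet := by
  obtain ⟨e, he⟩ := h
  obtain ⟨n, p, s, hps⟩ := E.exists_presentation
  have k : ∀ x, p (s x) = x := LinearMap.congr_fun hps
  rw [E.charDet_eq p s hps, F.charDet_eq (e.toLinearMap ∘ₗ p) (s ∘ₗ e.symm.toLinearMap)]
  · have : s ∘ₗ E.f ∘ₗ p = (s ∘ₗ e.symm.toLinearMap) ∘ₗ F.f ∘ₗ e.toLinearMap ∘ₗ p := by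
      refine LinearMap.ext fun x => ?_
      simp [← he]
    rw [this]
  · refine LinearMap.ext fun x => ?_
    simp [k]

theorem charDet_eq_one {E : EndObj A} (h : E.f = 0) : E.charDet = 1 := by
  obtain ⟨n, p, s, hps⟩ := E.exists_presentation
  rw [E.charDet_eq p s hps, h]
  simp [Matrix.charpolyRev]

theorem charDet_unit : (unit A).charDet = 1 - Polynomial.X := by
  let b : Module.Basis Unit A (unit A).carrier := Module.Basis.singleton Unit A
  have h : LinearMap.toMatrix b b (unit A).f = 1 := LinearMap.toMatrix_id b
  refine ((unit A).charDet_eq_of_basis b).trans ?_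
  rw [h]
  simp [Matrix.charpolyRev]

theorem const_charDet (E : EndObj A) : constantCoeff (E.charDet : A⟦X⟧) = 1 := by
  obtain ⟨n, p, s, hps⟩ := E.exists_presentation
  rw [E.charDet_eq p s hps, const_charpolyRev]

/-- Multiplicativity of the characteristic determinant in short exact sequences. -/
theorem ShortExact.charDet_eq {E' E E'' : EndObj A} (h : ShortExact E' E E'') :
    E.charDet = E'.charDet * E''.charDet := by
  obtain ⟨i, r, hi, hex, hr, hif, hrf⟩ := h
  obtain ⟨t, ht⟩ := r.exists_rightInverse_of_surjective (LinearMap.range_eq_top.2 hr)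
  have ht' : ∀ y, r (t y) = y := LinearMap.congr_fun ht
  have hri : ∀ x, r (i x) = 0 := fun x => (hex _).2 ⟨x, rfl⟩
  -- A splitting `E = i(E') ⊕ t(E'')` of modules: `x - t(r x)` lies in the kernel of `r`, which is
  -- the range of `i`. The section `t` need not commute with the endomorphisms.
  have hl : ∃ l : E.carrier →ₗ[A] E'.carrier, ∀ x, i (l x) = x - t (r x) := by
    let e := LinearEquiv.ofInjective i hi
    have hm : ∀ x, x - t (r x) ∈ LinearMap.range i := fun x =>
      (hex _).1 (by rw [map_sub, ht', sub_self])
    refine ⟨e.symm.toLinearMap ∘ₗ (LinearMap.id - t ∘ₗ r).codRestrict _ hm, fun x => ?_⟩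
    exact congrArg Subtype.val (e.apply_symm_apply ⟨x - t (r x), hm x⟩)
  obtain ⟨l, hl⟩ := hl
  have hli : ∀ x, l (i x) = x := fun x => hi (by rw [hl, hri, map_zero, sub_zero])
  obtain ⟨n', p', s', h'⟩ := E'.exists_presentation
  obtain ⟨n'', p'', s'', h''⟩ := E''.exists_presentation
  have k' : ∀ x, p' (s' x) = x := LinearMap.congr_fun h'
  have k'' : ∀ x, p'' (s'' x) = x := LinearMap.congr_fun h''
  let a := LinearEquiv.sumArrowLequivProdArrow (Fin n') (Fin n'') A A
  let p : (Fin n' ⊕ Fin n'' → A) →ₗ[A] E.carrier :=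
    (i ∘ₗ p').coprod (t ∘ₗ p'') ∘ₗ a.toLinearMap
  let s : E.carrier →ₗ[A] (Fin n' ⊕ Fin n'' → A) :=
    a.symm.toLinearMap ∘ₗ (s' ∘ₗ l).prod (s'' ∘ₗ r)
  have hp : ∀ x, p (a.symm x) = i (p' x.1) + t (p'' x.2) := fun x => by simp [p]
  have hs : ∀ x, s x = a.symm (s' (l x), s'' (r x)) := fun x => rfl
  have hps : p ∘ₗ s = .id := by
    ext x
    rw [LinearMap.comp_apply, hs, hp, k', k'', hl]
    simp
  rw [E.charDet_eq p s hps, E'.charDet_eq p' s' h', E''.charDet_eq p'' s'' h'']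
  -- The submodule `i(E')` is stable under `E.f`, so the lower left block is zero. The upper right
  -- block measures how far `t` is from commuting with the endomorphisms and does not affect the
  -- determinant.
  have hM : LinearMap.toMatrix' (s ∘ₗ E.f ∘ₗ p) = Matrix.fromBlocks
      (LinearMap.toMatrix' (s' ∘ₗ E'.f ∘ₗ p')) (LinearMap.toMatrix' (s' ∘ₗ l ∘ₗ E.f ∘ₗ t ∘ₗ p''))
      0 (LinearMap.toMatrix' (s'' ∘ₗ E''.f ∘ₗ p'')) := by
    apply Matrix.toLin'.injective
    rw [Matrix.toLin'_toMatrix']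
    refine LinearMap.ext fun x => ?_
    obtain ⟨⟨y, z⟩, rfl⟩ := a.symm.surjective x
    change s (E.f (p (a.symm (y, z)))) = _
    rw [hp, hs, Matrix.toLin'_apply, Matrix.fromBlocks_mulVec]
    have e1 : (a.symm (y, z)) ∘ Sum.inl = y := rfl
    have e2 : (a.symm (y, z)) ∘ Sum.inr = z := rfl
    rw [e1, e2]
    change Sum.elim _ _ = _
    simp only [LinearMap.toMatrix'_mulVec, Matrix.zero_mulVec, zero_add, map_add, ← hif, hri, hrf,
      hli, ht', LinearMap.comp_apply]
  rw [hM]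
  simp only [Matrix.charpolyRev]
  rw [← Matrix.det_fromBlocks_zero₂₁ _ (-((Polynomial.X : A[X]) • Matrix.map
    (LinearMap.toMatrix' (s' ∘ₗ l ∘ₗ E.f ∘ₗ t ∘ₗ p'')) Polynomial.C))]
  congr 1
  ext1 x y
  rcases x with x | x <;> rcases y with y | y <;> simp [Matrix.one_apply]

end EndObj

/-- The class `det(1 - X f) ^ (-q)` of a pair `(E, f)`. -/
noncomputable def LambdaQ.ofEndObj (q : ℕ) (E : EndObj A) : LambdaQ q A :=
  ⟨inv1 ((E.charDet : A⟦X⟧) ^ q), const_inv1 _⟩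

namespace LambdaQ

theorem ofEndObj_val_mul (E : EndObj A) :
    (ofEndObj q E).val * (E.charDet : A⟦X⟧) ^ q = 1 := by
  rw [mul_comm]
  exact mul_inv1 (by rw [map_pow, E.const_charDet, one_pow])

theorem ofEndObj_eq (E : EndObj A) {n : Type*} [Fintype n] [DecidableEq n]
    (p : (n → A) →ₗ[A] E.carrier) (s : E.carrier →ₗ[A] (n → A)) (h : p ∘ₗ s = .id) :
    ofEndObj q E = ofMatrix q (LinearMap.toMatrix' (s ∘ₗ E.f ∘ₗ p)) := by
  rw [ofEndObj, ofMatrix]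
  simp only [E.charDet_eq p s h]

theorem ofEndObj_unit : ofEndObj q (EndObj.unit A) = 1 := by
  refine LambdaQ.ext ?_
  rw [val_one]
  simp only [ofEndObj, EndObj.charDet_unit, factor]
  simp

/-- Presentations of `E` and `F` tensor to a presentation of `E ⊗ F`; in the product basis its
matrix is the Kronecker product. -/
theorem ofEndObj_tensor [NeZero q] [Invertible (q : A)] (E F : EndObj A) :
    ofEndObj q (E.tensor F) = ofEndObj q E * ofEndObj q F := by
  obtain ⟨m, p, s, h⟩ := E.exists_presentation
  obtain ⟨n, p', s', h'⟩ := F.exists_presentation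
  let b := (Pi.basisFun A (Fin m)).tensorProduct (Pi.basisFun A (Fin n))
  let e := b.equivFun
  rw [ofEndObj_eq E p s h, ofEndObj_eq F p' s' h', ofMatrix_mul,
    ofEndObj_eq (E.tensor F) (TensorProduct.map p p' ∘ₗ e.symm.toLinearMap)
      (e.toLinearMap ∘ₗ TensorProduct.map s s')]
  · congr 1
    have : Matrix.kronecker (LinearMap.toMatrix' (s ∘ₗ E.f ∘ₗ p))
        (LinearMap.toMatrix' (s' ∘ₗ F.f ∘ₗ p')) = LinearMap.toMatrix b b
        (TensorProduct.map (s ∘ₗ E.f ∘ₗ p) (s' ∘ₗ F.f ∘ₗ p')) := by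
      rw [TensorProduct.toMatrix_map]
      rfl
    rw [this, TensorProduct.map_comp, TensorProduct.map_comp]
    rfl
  · have : TensorProduct.map p p' ∘ₗ TensorProduct.map s s' = .id := by
      rw [← TensorProduct.map_comp, h, h', TensorProduct.map_id]
    refine LinearMap.ext fun x => ?_
    change TensorProduct.map p p' (e.symm (e (TensorProduct.map s s' x))) = x
    rw [e.symm_apply_apply]
    exact LinearMap.congr_fun this x

/-- The monoid homomorphism `(E, f) ↦ det(1 - X f) ^ (-q)` on isomorphism classes. -/
noncomputable def ofEndClass (q : ℕ) [NeZero q] [Invertible (q : A)] :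
    EndClass A →* LambdaQ q A where
  toFun := Quotient.lift (ofEndObj q) fun E F (h : EndObj.Iso E F) => by
    simp only [ofEndObj, h.charDet_eq]
  map_one' := ofEndObj_unit
  map_mul' := by
    rintro ⟨E⟩ ⟨F⟩
    exact ofEndObj_tensor E F

/-- The homomorphism induced by `(E, f) ↦ det(1 - X f) ^ (-q)` on `K₀`. -/
noncomputable def ofK0End (q : ℕ) [NeZero q] [Invertible (q : A)] : K0End A →+* LambdaQ q A :=
  Ideal.Quotient.lift (exactIdeal A) (FreeAbelianGroup.liftMonoid (ofEndClass q)) fun x hx => by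
    refine (Ideal.span_le (I := RingHom.ker _)).2 ?_ hx
    rintro _ ⟨E', E, E'', h, rfl⟩
    have hof : ∀ F : EndObj A,
        FreeAbelianGroup.liftMonoid (ofEndClass q) (freeClass F) = ofEndObj q F := fun F =>
      FreeAbelianGroup.lift_apply_of _ _
    change FreeAbelianGroup.liftMonoid (ofEndClass q) _ = 0
    rw [map_sub, map_sub, hof, hof, hof, sub_sub, sub_eq_zero]
    refine LambdaQ.ext (inv1_eq (by rw [map_pow, E.const_charDet, one_pow]) ?_)
    rw [val_add, h.charDet_eq, Polynomial.coe_mul, mul_pow]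
    linear_combination (ofEndObj q E'').val * (E''.charDet : A⟦X⟧) ^ q * ofEndObj_val_mul E' +
      ofEndObj_val_mul (q := q) E''

theorem ofK0End_mk [NeZero q] [Invertible (q : A)] (E : EndObj A) :
    ofK0End q (Ideal.Quotient.mk _ (freeClass E)) = ofEndObj q E :=
  FreeAbelianGroup.lift_apply_of _ _

/-- The homomorphism `L^q : W₀(A) → Λ^q(A)`. -/
noncomputable def ofW0 (q : ℕ) [NeZero q] [Invertible (q : A)] : W0 A →+* LambdaQ q A :=
  Ideal.Quotient.lift (zeroIdeal A) (ofK0End q) fun x hx => by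
    refine (Ideal.span_le (I := RingHom.ker (ofK0End q))).2 ?_ hx
    rintro _ ⟨E, h, rfl⟩
    change ofK0End q _ = 0
    rw [ofK0End_mk]
    refine LambdaQ.ext (inv1_eq (by rw [map_pow, E.const_charDet, one_pow]) ?_)
    rw [EndObj.charDet_eq_one h, val_zero]
    simp

theorem ofW0_mk [NeZero q] [Invertible (q : A)] (E : EndObj A) :
    ofW0 q (W0.mk E) = ofEndObj q E := ofK0End_mk E

end LambdaQ

end CharDet

/-! ### The Artin–Hasse isomorphism. -/

section ArtinHasse

open PowerSeries

variable {q : ℕ}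

variable {A B : Type u} [CommRing A] [CommRing B]

theorem infProd_congr {u v : ℕ → A⟦X⟧} (h : ∀ n, 1 ≤ n → u n = v n) : infProd u = infProd v := by
  ext k
  rw [infProd, infProd, coeff_mk, coeff_mk]
  refine congrArg _ (Finset.prod_congr rfl fun n hn => h n (Finset.mem_Icc.1 hn).1)

/-- Uniqueness of the factorization `∏ (1 - a_n X ^ n)`. -/
theorem infProd_factor_injective {a b : ℕ → A}
    (h : infProd (fun n => factor (a n) n) = infProd fun n => factor (b n) n) :
    ∀ n, 1 ≤ n → a n = b n := by
  intro n
  induction n using Nat.strong_induction_on with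
  | _ n ih =>
    intro hn
    obtain ⟨k, rfl⟩ : ∃ k, n = k + 1 := ⟨n - 1, by omega⟩
    -- Factors of index above `k + 1` do not reach degree `k + 1`, and the factor of index `k + 1`
    -- subtracts exactly `c (k + 1)`; the earlier factors agree by induction.
    have key : ∀ c : ℕ → A, coeff (k + 1) (infProd fun n => factor (c n) n) =
        coeff (k + 1) (∏ n ∈ Finset.Icc 1 k, factor (c n) n) - c (k + 1) := fun c => by
      have hP : constantCoeff (∏ n ∈ Finset.Icc 1 k, factor (c n) n) = 1 := by
        rw [map_prod]
        exact Finset.prod_eq_one fun n hn =>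
          const_of_dvd (Finset.mem_Icc.1 hn).1 (factor_dvd _ le_rfl)
      have := coeff_mul_factor_pow (q := 1) _ hP (c (k + 1)) k
      rw [pow_one, Nat.cast_one, one_mul] at this
      rw [infProd, coeff_mk, Finset.prod_Icc_succ_top (by omega), this]
    have e := congrArg (coeff (k + 1)) h
    have hprod : ∏ n ∈ Finset.Icc 1 k, factor (a n) n = ∏ n ∈ Finset.Icc 1 k, factor (b n) n :=
      Finset.prod_congr rfl fun n hn => by
        have := Finset.mem_Icc.1 hn
        rw [ih n (by omega) this.1]
    rw [key, key, hprod] at e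
    exact sub_right_injective e

theorem artinHasse_injective [Invertible (q : A)] :
    Function.Injective (artinHasse (q := q) (A := A)) := by
  intro x y h
  have h1 := congrArg (fun f => inv1 (LambdaQ.val f)) h
  simp only [artinHasse] at h1
  rw [inv1_inv1 (const_infProd _), inv1_inv1 (const_infProd _)] at h1
  refine QWitt.ext (funext fun n => ?_)
  have := infProd_factor_injective h1 n n.pos
  rw [PNat.coe_toPNat'] at this
  exact (isUnit_of_invertible (q : A)).mul_left_cancel this

theorem artinHasse_surjective [Invertible (q : A)] :
    Function.Surjective (artinHasse (q := q) (A := A)) := by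
  intro f
  -- The case `q = 1` of `infProd_coord` writes `inv1 f` as `∏ (1 - a_n X^n)`; the preimage has the
  -- components `a_n / q`.
  let : Invertible ((1 : ℕ) : A) := invertibleOne.copy _ Nat.cast_one
  refine ⟨⟨fun n => ⅟(q : A) * coord 1 f.val n⟩, LambdaQ.ext ?_⟩
  have h := infProd_coord (q := 1) (f := f.val)
  have e : infProd (fun n => factor ((q : A) * (⅟(q : A) * coord 1 f.val n.toPNat')) n) =
      inv1 f.val := by
    rw [← h]
    refine infProd_congr fun n hn => ?_
    rw [mul_invOf_cancel_left', pow_one, Nat.toPNat'_coe, if_pos (show 0 < n from hn)]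
  change inv1 (infProd _) = _
  rw [e, inv1_inv1 f.const]

theorem mapFun_artinHasse (φ : A →+* B) (x : QWitt q A) :
    LambdaQ.mapFun φ (artinHasse x) = artinHasse (QWitt.mapFun φ x) := by
  refine LambdaQ.ext ?_
  change PowerSeries.map φ (inv1 _) = inv1 _
  rw [map_inv1 φ (const_infProd _), map_infProd]
  simp only [map_factor, map_mul, map_natCast]
  rfl

/-- The logarithmic derivative of the Artin--Hasse map in terms of ghost components. -/
theorem logDer_artinHasse (x : QWitt q A) (n : ℕ+) :
    coeff (n : ℕ) (logDer (artinHasse x).val) = q * ghost q x.comp n := by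
  rw [artinHasse, logDer_inv1 (const_infProd _), map_neg,
    coeff_logDer_infProd _ (fun n _ => factor_dvd _ le_rfl), ghost, Finset.mul_sum,
    ← Finset.sum_neg_distrib, Nat.divisors, ← Finset.sum_filter_add_sum_filter_not _ (· ∣ (n : ℕ))]
  rw [Finset.sum_eq_zero (s := Finset.filter (fun d => ¬ d ∣ (n : ℕ)) _), add_zero]
  · refine Finset.sum_congr rfl fun d hd => ?_
    rw [Finset.mem_filter, Finset.mem_Ico, Nat.lt_succ_iff] at hd
    rw [coeff_logDer_factor _ hd.1.1 n.pos, if_pos hd.2, neg_neg, mul_pow]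
    have : (n : ℕ) / d ≠ 0 := (Nat.div_pos hd.1.2 hd.1.1).ne'
    -- One factor `q` comes out of `q^(n/d)`; the exponent left is the `n/d - 1` of the ghost
    -- component.
    rw [← mul_pow_sub_one this]
    ring
  · intro d hd
    rw [Finset.mem_filter, Finset.mem_Icc] at hd
    rw [coeff_logDer_factor _ hd.1.1 n.pos, if_neg hd.2, neg_zero]

/-- Both sides have logarithmic derivative `q` times the sum of the ghost components, which decides
equality after lifting to a domain of characteristic zero. -/
theorem artinHasse_add [NeZero q] [Invertible (q : A)] (x y : QWitt q A) :
    artinHasse (x + y) = artinHasse x + artinHasse y := by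
  obtain ⟨R, _, _, _, _, φ, hφ⟩ := LambdaQ.exists_cover q A
  choose s hs using hφ
  have lift : ∀ x : QWitt q A, x = QWitt.mapFun φ ⟨fun n => s (x.comp n)⟩ := fun x =>
    QWitt.ext (funext fun n => (hs _).symm)
  rw [lift x, lift y, ← QWitt.mapFun_add, ← mapFun_artinHasse, ← mapFun_artinHasse,
    ← mapFun_artinHasse, ← LambdaQ.mapFun_add]
  refine congrArg _ (LambdaQ.ext_logDer fun k hk => ?_)
  lift k to ℕ+ using hk
  rw [LambdaQ.logDer_add_val, logDer_artinHasse, logDer_artinHasse, logDer_artinHasse,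
    QWitt.ghost_add, mul_add]

/-- On ghost components this is `q Φ(x) Φ(y) = q⁻¹ (q Φ(x)) (q Φ(y))`, again checked over a domain
of characteristic zero. -/
theorem artinHasse_mul [NeZero q] [Invertible (q : A)] (x y : QWitt q A) :
    artinHasse (x * y) = artinHasse x * artinHasse y := by
  obtain ⟨R, _, _, _, _, φ, hφ⟩ := LambdaQ.exists_cover q A
  choose s hs using hφ
  have lift : ∀ x : QWitt q A, x = QWitt.mapFun φ ⟨fun n => s (x.comp n)⟩ := fun x =>
    QWitt.ext (funext fun n => (hs _).symm)
  rw [lift x, lift y, ← QWitt.mapFun_mul, ← mapFun_artinHasse, ← mapFun_artinHasse,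
    ← mapFun_artinHasse, ← LambdaQ.mapFun_mul]
  refine congrArg _ (LambdaQ.ext_logDer fun k hk => ?_)
  have hk' := hk
  lift k to ℕ+ using hk'
  rw [LambdaQ.logDer_mul_val _ _ hk, logDer_artinHasse, logDer_artinHasse, logDer_artinHasse,
    QWitt.ghost_mul]
  linear_combination (-(q : R) * ghost q (fun n => s (x.comp n)) k *
    ghost q (fun n => s (y.comp n)) k) * invOf_mul_self (q : R)

/-- The Artin--Hasse isomorphism `W^q(A) ≃ Λ^q(A)` when `q` is invertible. -/
noncomputable def artinHasseEquiv (q : ℕ) (A : Type u) [CommRing A] [NeZero q]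
    [Invertible (q : A)] : QWitt q A ≃+* LambdaQ q A where
  toEquiv := Equiv.ofBijective artinHasse ⟨artinHasse_injective, artinHasse_surjective⟩
  map_add' := artinHasse_add
  map_mul' := artinHasse_mul

end ArtinHasse

/-! ### Classes in `W₀(A)` of `A[X]`-modules and of cokernels. -/

section Cokernel

open Polynomial

variable {A : Type u} [CommRing A]

theorem W0.mk_eq_of_iso {E F : EndObj A} (h : EndObj.Iso E F) : W0.mk E = W0.mk F := by
  have : freeClass E = freeClass F := congrArg FreeAbelianGroup.of (Quotient.sound h)
  rw [W0.mk, W0.mk, this]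

theorem W0.mk_shortExact {E' E E'' : EndObj A} (h : EndObj.ShortExact E' E E'') :
    W0.mk E = W0.mk E' + W0.mk E'' := by
  have : Ideal.Quotient.mk (exactIdeal A) (freeClass E - freeClass E' - freeClass E'') = 0 :=
    Ideal.Quotient.eq_zero_iff_mem.2 (Ideal.subset_span ⟨E', E, E'', h, rfl⟩)
  rw [map_sub, map_sub, sub_sub, sub_eq_zero] at this
  rw [W0.mk, this, map_add]
  rfl

theorem W0.mk_eq_zero {E : EndObj A} (h : E.f = 0) : W0.mk E = 0 :=
  Ideal.Quotient.eq_zero_iff_mem.2 (Ideal.subset_span ⟨E, h, rfl⟩)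

/-! #### Classes of `A[X]`-modules -/

/-- An `A[X]`-module, finitely generated and projective over `A`, as a pair `(E, f)`: the
endomorphism is the multiplication by `X`. -/
noncomputable def EndObj.ofModule (V : Type u) [AddCommGroup V] [Module A V] [Module A[X] V]
    [IsScalarTower A A[X] V] [Module.Finite A V] [Module.Projective A V] : EndObj A where
  carrier := V
  f := (LinearMap.lsmul A[X] V X).restrictScalars A

section

variable (A) in
/-- Finitely generated projective modules. -/
def IsFinProj (V : Type*) [AddCommGroup V] [Module A V] : Prop :=
  Module.Finite A V ∧ Module.Projective A V

theorem IsFinProj.of_equiv {V V' : Type*} [AddCommGroup V] [Module A V] [AddCommGroup V']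
    [Module A V'] (e : V ≃ₗ[A] V') (h : IsFinProj A V) : IsFinProj A V' := by
  obtain ⟨_, _⟩ := h
  exact ⟨Module.Finite.equiv e, Module.Projective.of_equiv e⟩

open Classical in
/-- The class in `W₀(A)` of an `A[X]`-module which is finitely generated projective over `A`. -/
noncomputable def modClass (V : Type u) [AddCommGroup V] [Module A V] [Module A[X] V]
    [IsScalarTower A A[X] V] : W0 A :=
  if h : IsFinProj A V then
    have := h.1
    have := h.2
    W0.mk (EndObj.ofModule V) else 0

variable {V V' V'' : Type u} [AddCommGroup V] [Module A V] [Module A[X] V]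
  [IsScalarTower A A[X] V] [AddCommGroup V'] [Module A V'] [Module A[X] V']
  [IsScalarTower A A[X] V'] [AddCommGroup V''] [Module A V''] [Module A[X] V'']
  [IsScalarTower A A[X] V'']

theorem modClass_eq [Module.Finite A V] [Module.Projective A V] :
    modClass V = W0.mk (EndObj.ofModule (A := A) V) :=
  dif_pos ⟨inferInstance, inferInstance⟩

theorem modClass_congr (e : V ≃ₗ[A[X]] V') : (modClass V : W0 A) = modClass V' := by
  by_cases h : IsFinProj A V
  · have h' := h.of_equiv (e.restrictScalars A)
    obtain ⟨_, _⟩ := h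
    obtain ⟨_, _⟩ := h'
    rw [modClass_eq, modClass_eq]
    exact W0.mk_eq_of_iso ⟨e.restrictScalars A, fun x => e.map_smul X x⟩
  · have h' : ¬ IsFinProj A V' := fun h' => h (h'.of_equiv (e.restrictScalars A).symm)
    rw [modClass, modClass, dif_neg h, dif_neg h']

theorem modClass_eq_zero [Subsingleton V] : (modClass V : W0 A) = 0 := by
  have : Module.Projective A V := inferInstance
  rw [modClass_eq]
  exact W0.mk_eq_zero (LinearMap.ext fun x => Subsingleton.elim (α := V) _ _)

variable {i : V' →ₗ[A[X]] V} {p : V →ₗ[A[X]] V''}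

/-- As `V''` is projective over `A`, the sequence splits `A`-linearly, though in general not
`A[X]`-linearly. -/
theorem nonempty_equiv_prod (hi : Function.Injective i) (hex : Function.Exact i p)
    (hp : Function.Surjective p) (h'' : IsFinProj A V'') : Nonempty (V ≃ₗ[A] V' × V'') := by
  obtain ⟨_, _⟩ := h''
  have hex' : Function.Exact (i.restrictScalars A) (p.restrictScalars A) := hex
  obtain ⟨l, hl⟩ := (p.restrictScalars A).exists_rightInverse_of_surjective
    (LinearMap.range_eq_top.2 hp)
  have hsplit := (Function.Exact.split_tfae' hex').out 0 2
  obtain ⟨e, -⟩ := hsplit.1 ⟨hi, l, hl⟩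
  exact ⟨e⟩

theorem IsFinProj.of_exact_middle (hi : Function.Injective i) (hex : Function.Exact i p)
    (hp : Function.Surjective p) (h' : IsFinProj A V') (h'' : IsFinProj A V'') :
    IsFinProj A V := by
  obtain ⟨e⟩ := nonempty_equiv_prod hi hex hp h''
  obtain ⟨_, _⟩ := h'
  obtain ⟨_, _⟩ := h''
  exact IsFinProj.of_equiv e.symm ⟨inferInstance, inferInstance⟩

theorem IsFinProj.of_exact_left (hi : Function.Injective i) (hex : Function.Exact i p)
    (hp : Function.Surjective p) (h : IsFinProj A V) (h'' : IsFinProj A V'') :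
    IsFinProj A V' := by
  obtain ⟨e⟩ := nonempty_equiv_prod hi hex hp h''
  obtain ⟨_, _⟩ := h.of_equiv e
  exact ⟨Module.Finite.of_surjective (LinearMap.fst A V' V'') LinearMap.fst_surjective,
    Module.Projective.of_split (LinearMap.inl A V' V'') (LinearMap.fst A V' V'')
      (LinearMap.fst_comp_inl A V' V'')⟩

theorem modClass_exact (hi : Function.Injective i) (hex : Function.Exact i p)
    (hp : Function.Surjective p) (h' : IsFinProj A V') (h'' : IsFinProj A V'') :
    (modClass V : W0 A) = modClass V' + modClass V'' := by
  obtain ⟨_, _⟩ := IsFinProj.of_exact_middle hi hex hp h' h''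
  obtain ⟨_, _⟩ := h'
  obtain ⟨_, _⟩ := h''
  rw [modClass_eq, modClass_eq, modClass_eq]
  exact W0.mk_shortExact ⟨i.restrictScalars A, p.restrictScalars A, hi, hex, hp,
    fun x => i.map_smul X x, fun x => p.map_smul X x⟩

end

/-! #### Cokernels -/

section

variable {R N N' N'' : Type*} [CommRing R] [AddCommGroup N] [Module R N]
  [AddCommGroup N'] [Module R N'] [AddCommGroup N''] [Module R N'']

/-- The cokernel of an endomorphism. -/
abbrev Coker (u : N →ₗ[R] N) : Type _ := N ⧸ LinearMap.range u

/-- The cokernels of conjugate endomorphisms are isomorphic. -/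
noncomputable def cokerEquiv (u : N →ₗ[R] N) (u' : N' →ₗ[R] N') (e : N ≃ₗ[R] N')
    (h : ∀ x, e (u x) = u' (e x)) : Coker u ≃ₗ[R] Coker u' :=
  Submodule.Quotient.equiv _ _ e (by
    ext y
    simp only [Submodule.mem_map, LinearMap.mem_range]
    constructor
    · rintro ⟨_, ⟨x, rfl⟩, rfl⟩
      exact ⟨e x, (h x).symm⟩
    · rintro ⟨x, rfl⟩
      exact ⟨u (e.symm x), ⟨_, rfl⟩, by simp [h]⟩)

/-- The map induced on cokernels by a map of endomorphisms. -/
def cokerMap (u' : N' →ₗ[R] N') (u : N →ₗ[R] N) (i : N' →ₗ[R] N)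
    (h : ∀ x, i (u' x) = u (i x)) : Coker u' →ₗ[R] Coker u :=
  Submodule.mapQ _ _ i (by rintro _ ⟨x, rfl⟩; exact ⟨i x, (h x).symm⟩)

variable {u' : N' →ₗ[R] N'} {u : N →ₗ[R] N} {u'' : N'' →ₗ[R] N''} {i : N' →ₗ[R] N}
  {p : N →ₗ[R] N''}

/-- Part of the snake lemma: the kernel of the map of cokernels is the image of the kernel of `u''`
under the connecting map. -/
theorem cokerMap_injective (hex : Function.Exact i p) (hinj : Function.Injective i)
    (hi : ∀ x, i (u' x) = u (i x)) (hp : ∀ x, p (u x) = u'' (p x))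
    (hu : Function.Injective u'') : Function.Injective (cokerMap u' u i hi) := by
  refine (injective_iff_map_eq_zero _).2 fun x hx => ?_
  obtain ⟨x, rfl⟩ := Submodule.mkQ_surjective _ x
  obtain ⟨y, hy⟩ := (Submodule.Quotient.mk_eq_zero _).1 hx
  have h1 : p y = 0 := hu (by rw [← hp, hy, map_zero]; exact (hex _).2 ⟨x, rfl⟩)
  obtain ⟨z, rfl⟩ := (hex _).1 h1
  rw [← hi] at hy
  exact (Submodule.Quotient.mk_eq_zero _).2 ⟨z, hinj hy⟩

theorem cokerMap_exact (hex : Function.Exact i p) (hsurj : Function.Surjective p)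
    (hi : ∀ x, i (u' x) = u (i x)) (hp : ∀ x, p (u x) = u'' (p x)) :
    Function.Exact (cokerMap u' u i hi) (cokerMap u u'' p hp) := by
  intro y
  constructor
  · intro hy
    obtain ⟨y, rfl⟩ := Submodule.mkQ_surjective _ y
    obtain ⟨z, hz⟩ := (Submodule.Quotient.mk_eq_zero _).1 hy
    obtain ⟨w, rfl⟩ := hsurj z
    obtain ⟨x, hx⟩ := (hex (y - u w)).1 (by rw [map_sub, hp, hz, sub_self])
    refine ⟨Submodule.Quotient.mk x, (Submodule.Quotient.eq _).2 ⟨-w, ?_⟩⟩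
    rw [hx, map_neg]
    abel
  · rintro ⟨x, rfl⟩
    obtain ⟨x, rfl⟩ := Submodule.mkQ_surjective _ x
    refine (Submodule.Quotient.mk_eq_zero _).2 ⟨0, ?_⟩
    rw [map_zero]
    exact ((hex _).2 ⟨x, rfl⟩).symm

theorem cokerMap_surjective (hsurj : Function.Surjective p)
    (hp : ∀ x, p (u x) = u'' (p x)) : Function.Surjective (cokerMap u u'' p hp) := by
  intro y
  obtain ⟨y, rfl⟩ := Submodule.mkQ_surjective _ y
  obtain ⟨x, rfl⟩ := hsurj y
  exact ⟨Submodule.Quotient.mk x, rfl⟩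

variable {v w : N →ₗ[R] N}

/-- The map `coker v → coker (u v)` induced by `u`. -/
def cokerCompLeft (u v w : N →ₗ[R] N) (h : u ∘ₗ v = w) : Coker v →ₗ[R] Coker w :=
  Submodule.mapQ _ _ u (by rintro _ ⟨x, rfl⟩; exact ⟨x, by rw [← h]; rfl⟩)

/-- The projection `coker (u v) → coker u`. -/
def cokerCompRight (u v w : N →ₗ[R] N) (h : u ∘ₗ v = w) : Coker w →ₗ[R] Coker u :=
  Submodule.mapQ _ _ LinearMap.id (by rintro _ ⟨x, rfl⟩; exact ⟨v x, by rw [← h]; rfl⟩)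

theorem cokerCompLeft_injective (h : u ∘ₗ v = w) (hu : Function.Injective u) :
    Function.Injective (cokerCompLeft u v w h) := by
  refine (injective_iff_map_eq_zero _).2 fun x hx => ?_
  obtain ⟨x, rfl⟩ := Submodule.mkQ_surjective _ x
  obtain ⟨y, hy⟩ := (Submodule.Quotient.mk_eq_zero _).1 hx
  rw [← h] at hy
  exact (Submodule.Quotient.mk_eq_zero _).2 ⟨y, hu hy⟩

/-- For injective `u` this is the middle of `0 → coker v → coker (u v) → coker u → 0`, which turns a
factorization of matrices or polynomials into a sum of classes. -/
theorem cokerComp_exact (h : u ∘ₗ v = w) :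
    Function.Exact (cokerCompLeft u v w h) (cokerCompRight u v w h) := by
  intro y
  constructor
  · intro hy
    obtain ⟨y, rfl⟩ := Submodule.mkQ_surjective _ y
    obtain ⟨z, hz⟩ := (Submodule.Quotient.mk_eq_zero _).1 hy
    exact ⟨Submodule.Quotient.mk z, congrArg Submodule.Quotient.mk hz⟩
  · rintro ⟨x, rfl⟩
    obtain ⟨x, rfl⟩ := Submodule.mkQ_surjective _ x
    exact (Submodule.Quotient.mk_eq_zero _).2 ⟨x, rfl⟩

theorem cokerCompRight_surjective (h : u ∘ₗ v = w) :
    Function.Surjective (cokerCompRight u v w h) := by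
  intro y
  obtain ⟨y, rfl⟩ := Submodule.mkQ_surjective _ y
  exact ⟨Submodule.Quotient.mk y, rfl⟩

end

/-! #### Cyclic modules -/

/-- The class of `A[X] / (p)`. -/
noncomputable def cyclicClass (p : A[X]) : W0 A := modClass (Coker (LinearMap.mulLeft A[X] p))

theorem isFinProj_cyclic {p : A[X]} (hp : p.Monic) :
    IsFinProj A (Coker (LinearMap.mulLeft A[X] p)) := by
  have h : Ideal.span {p} = LinearMap.range (LinearMap.mulLeft A[X] p) := by
    ext x
    rw [Ideal.mem_span_singleton]
    exact ⟨fun ⟨y, hy⟩ => ⟨y, hy.symm⟩, fun ⟨y, hy⟩ => ⟨y, hy.symm⟩⟩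
  have h1 : Module.Finite A (A[X] ⧸ Ideal.span {p}) := hp.finite_quotient
  have h2 : Module.Free A (A[X] ⧸ Ideal.span {p}) := hp.free_adjoinRoot
  exact IsFinProj.of_equiv ((Submodule.quotEquivOfEq _ _ h).restrictScalars A)
    ⟨h1, inferInstance⟩

/-- From `0 → A[X]/(r) → A[X]/(p r) → A[X]/(p) → 0`, whose first map is multiplication by `p`,
injective because a monic polynomial is regular. -/
theorem cyclicClass_mul {p r : A[X]} (hp : p.Monic) (hr : r.Monic) :
    cyclicClass (p * r) = cyclicClass p + cyclicClass r := by
  have h : LinearMap.mulLeft A[X] p ∘ₗ LinearMap.mulLeft A[X] r = LinearMap.mulLeft A[X] (p * r) :=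
    LinearMap.ext fun x => (mul_assoc p r x).symm
  rw [cyclicClass, modClass_exact (cokerCompLeft_injective h fun x y e => hp.isRegular.left e)
    (cokerComp_exact h) (cokerCompRight_surjective h) (isFinProj_cyclic hr)
    (isFinProj_cyclic hp), add_comm]
  rfl

theorem cyclicClass_one : cyclicClass (1 : A[X]) = 0 := by
  have := cyclicClass_mul (monic_one (R := A)) monic_one
  rw [mul_one] at this
  exact left_eq_add.1 this

/-- By additivity it is enough to treat `A[X]/(X)`, on which `X` acts as zero. Here the quotient by
the pairs `(E, 0)` enters; it makes up for the powers of `X` that reversing a polynomial loses. -/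
theorem cyclicClass_X_pow (m : ℕ) : cyclicClass (X ^ m : A[X]) = 0 := by
  induction m with
  | zero => rw [pow_zero, cyclicClass_one]
  | succ m ih =>
    rw [pow_succ, cyclicClass_mul (monic_X_pow m) monic_X, ih, zero_add, cyclicClass]
    obtain ⟨_, _⟩ := isFinProj_cyclic (monic_X (R := A))
    rw [modClass_eq]
    refine W0.mk_eq_zero (LinearMap.ext fun x => ?_)
    obtain ⟨x, rfl⟩ := Submodule.mkQ_surjective _ x
    exact (Submodule.Quotient.mk_eq_zero _).2 ⟨x, rfl⟩

end Cokernel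

/-! ### Cokernels of polynomial matrices and their determinants. -/

section MatrixCokernel

open Polynomial Matrix

variable {A : Type u} [CommRing A]

/-- The cokernel of a square matrix of polynomials. -/
abbrev matCoker {ι : Type} [Fintype ι] (P : Matrix ι ι A[X]) : Type u := Coker P.mulVecLin

/-- The adjugate reduces `P x = 0` to `det P • x = 0`, and a monic determinant is regular. -/
theorem mulVecLin_injective_of_monic {ι : Type} [Fintype ι] [DecidableEq ι] {P : Matrix ι ι A[X]}
    (h : P.det.Monic) : Function.Injective P.mulVecLin := by
  refine (injective_iff_map_eq_zero _).2 fun x hx => ?_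
  have e : P.det • x = 0 := by
    have : P.adjugate *ᵥ (P *ᵥ x) = 0 := by
      rw [show P *ᵥ x = 0 from hx, mulVec_zero]
    rwa [mulVec_mulVec, adjugate_mul, smul_mulVec, one_mulVec] at this
  funext j
  exact h.isRegular.left (by simpa using congrFun e j)

/-- Square matrices of polynomials of the form `X ^ d + (terms of lower degree)`. -/
def IsMonicMatrix {ι : Type} [DecidableEq ι] (d : ℕ) (P : Matrix ι ι A[X]) : Prop :=
  ∀ i j, P i j - (if i = j then X ^ d else 0) ∈ degreeLT A d

theorem mul_mem_degreeLT {d : ℕ} {p r : A[X]} (hp : p ∈ degreeLT A d) (hr : r.degree ≤ d) :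
    p * r ∈ degreeLT A (d + d) := by
  rw [mem_degreeLT] at *
  calc (p * r).degree ≤ p.degree + r.degree := degree_mul_le p r
    _ ≤ p.degree + d := by gcongr
    _ < d + d := WithBot.add_lt_add_right (WithBot.coe_ne_bot) hp
    _ = ((d + d : ℕ) : WithBot ℕ) := by push_cast; rfl

/-- This is the Schur complement of `a`, multiplied by `a` to avoid division. Only the product of
the leading terms of `a` and `D` reaches degree `2d`, so elimination stays within monic matrices. -/
theorem isMonicMatrix_schur {n : Type} [DecidableEq n] [Fintype n] {d : ℕ} {a : A[X]}
    {b c : n → A[X]} {D : Matrix n n A[X]} (ha : a - X ^ d ∈ degreeLT A d)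
    (hb : ∀ i, b i ∈ degreeLT A d) (hc : ∀ i, c i ∈ degreeLT A d) (hD : IsMonicMatrix d D) :
    IsMonicMatrix (d + d) (a • D - vecMulVec c b) := by
  intro i j
  have hX : (X ^ d : A[X]).degree ≤ d := degree_X_pow_le d
  have hle : ∀ {p : A[X]}, p ∈ degreeLT A d → p.degree ≤ d := fun h => (mem_degreeLT.1 h).le
  have key : (a • D - vecMulVec c b) i j - (if i = j then X ^ (d + d) else 0) =
      (a - X ^ d) * (D i j - if i = j then X ^ d else 0) +
      (a - X ^ d) * (if i = j then X ^ d else 0) +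
      (D i j - if i = j then X ^ d else 0) * X ^ d - c i * b j := by
    simp only [Matrix.sub_apply, Matrix.smul_apply, vecMulVec_apply, smul_eq_mul]
    split_ifs <;> ring
  rw [key]
  refine sub_mem (add_mem (add_mem (mul_mem_degreeLT ha (hle (hD i j)))
    (mul_mem_degreeLT ha ?_)) (mul_mem_degreeLT (hD i j) hX)) (mul_mem_degreeLT (hc i) (hle (hb j)))
  split_ifs
  · exact hX
  · simp

theorem monic_of_sub_mem_degreeLT {d : ℕ} {a : A[X]} (ha : a - X ^ d ∈ degreeLT A d) :
    a.Monic := by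
  have := monic_X_pow_add (mem_degreeLT.1 ha)
  rwa [add_sub_cancel] at this

/-- The cokernel of a conjugate matrix. -/
noncomputable def matCokerReindex {ι κ : Type} [Fintype ι] [Fintype κ] (e : ι ≃ κ)
    (P : Matrix ι ι A[X]) : matCoker P ≃ₗ[A[X]] matCoker (reindex e e P) :=
  cokerEquiv _ _ (LinearEquiv.funCongrLeft A[X] A[X] e.symm) fun x => by
    funext j
    simp only [LinearEquiv.funCongrLeft_apply, LinearMap.funLeft_apply, mulVecLin_apply,
      mulVec, dotProduct, reindex_apply, submatrix_apply]
    exact (e.symm.sum_comp fun i => P (e.symm j) i * x i).symm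

/-- The cokernel of a one by one matrix. -/
noncomputable def matCokerUnit (a : A[X]) :
    matCoker (of fun _ _ : Unit => a) ≃ₗ[A[X]] Coker (LinearMap.mulLeft A[X] a) :=
  cokerEquiv _ _ (LinearEquiv.funUnique Unit A[X] A[X]) fun x => by
    simp [mulVec, dotProduct]

section Blocks

variable {m n : Type}

/-- The inclusion of the first block of coordinates. -/
def inlFun (m n : Type) (R : Type*) [CommRing R] : (m → R) →ₗ[R] (m ⊕ n → R) where
  toFun x := Sum.elim x 0
  map_add' x y := by ext (i | i) <;> simp
  map_smul' r x := by ext (i | i) <;> simp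

theorem exact_inlFun (R : Type*) [CommRing R] :
    Function.Exact (inlFun m n R) (LinearMap.funLeft R R (Sum.inr : n → m ⊕ n)) := by
  intro y
  constructor
  · intro h
    refine ⟨y ∘ Sum.inl, ?_⟩
    ext (i | i)
    · rfl
    · exact (congrFun h i).symm
  · rintro ⟨x, rfl⟩
    rfl

theorem inlFun_injective (R : Type*) [CommRing R] : Function.Injective (inlFun m n R) :=
  fun _ _ h => funext fun i => congrFun h (Sum.inl i)

variable [Fintype m] [Fintype n] {a : Matrix m m A[X]} {b : Matrix m n A[X]} {D : Matrix n n A[X]}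

/-- The first block of coordinates is a stable submodule with quotient the second. Injectivity of
`D` makes the induced sequence of cokernels exact on the left. -/
theorem matCoker_fromBlocks [DecidableEq n] (hD : D.det.Monic) (h1 : IsFinProj A (matCoker a))
    (h2 : IsFinProj A (matCoker D)) :
    IsFinProj A (matCoker (fromBlocks a b 0 D)) ∧
      (modClass (matCoker (fromBlocks a b 0 D)) : W0 A) =
        modClass (matCoker a) + modClass (matCoker D) := by
  have hi : ∀ x, inlFun m n A[X] (a.mulVecLin x) =
      (fromBlocks a b 0 D).mulVecLin (inlFun m n A[X] x) := fun x => by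
    ext1 (i | i) <;> simp [inlFun, fromBlocks_mulVec]
  have hp : ∀ x, LinearMap.funLeft A[X] A[X] (Sum.inr : n → m ⊕ n)
      ((fromBlocks a b 0 D).mulVecLin x) =
      D.mulVecLin (LinearMap.funLeft A[X] A[X] Sum.inr x) := fun x => by
    ext1 i
    simp [fromBlocks_mulVec, LinearMap.funLeft]
  have hs := LinearMap.funLeft_surjective_of_injective A[X] A[X] _
    (Sum.inr_injective (α := m) (β := n))
  have e1 := cokerMap_injective (exact_inlFun A[X]) (inlFun_injective A[X]) hi hp
    (mulVecLin_injective_of_monic hD)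
  have e2 := cokerMap_exact (exact_inlFun A[X]) hs hi hp
  have e3 := cokerMap_surjective hs hp
  exact ⟨IsFinProj.of_exact_middle e1 e2 e3 h1 h2, modClass_exact e1 e2 e3 h1 h2⟩

theorem matCoker_fromBlocks' [DecidableEq m] {c : Matrix n m A[X]} (ha : a.det.Monic)
    (h1 : IsFinProj A (matCoker a)) (h2 : IsFinProj A (matCoker D)) :
    IsFinProj A (matCoker (fromBlocks a 0 c D)) ∧
      (modClass (matCoker (fromBlocks a 0 c D)) : W0 A) =
        modClass (matCoker a) + modClass (matCoker D) := by
  have e : reindex (Equiv.sumComm n m) (Equiv.sumComm n m) (fromBlocks D c 0 a) =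
      fromBlocks a 0 c D := by
    ext1 (i | i) (j | j) <;> rfl
  obtain ⟨k1, k2⟩ := matCoker_fromBlocks (b := c) ha h2 h1
  rw [← e]
  have f := matCokerReindex (Equiv.sumComm n m) (fromBlocks D c 0 a)
  exact ⟨k1.of_equiv (f.restrictScalars A), by rw [← modClass_congr f, k2, add_comm]⟩

end Blocks

variable (A) in
/-- The class of the cokernel of a matrix is determined by its determinant. -/
def DetDeterminesClass (ι : Type) [Fintype ι] [DecidableEq ι] : Prop :=
  ∀ (d : ℕ) (P : Matrix ι ι A[X]), IsMonicMatrix d P → P.det.Monic ∧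
    IsFinProj A (matCoker P) ∧ (modClass (matCoker P) : W0 A) = cyclicClass P.det

theorem DetDeterminesClass.of_equiv {ι κ : Type} [Fintype ι] [DecidableEq ι] [Fintype κ]
    [DecidableEq κ] (e : ι ≃ κ) (h : DetDeterminesClass A κ) : DetDeterminesClass A ι := by
  intro d P hP
  have hP' : IsMonicMatrix d (reindex e e P) := fun i j => by
    have := hP (e.symm i) (e.symm j)
    simpa using this
  obtain ⟨h1, h2, h3⟩ := h d _ hP'
  rw [det_reindex_self] at h1 h3
  refine ⟨h1, h2.of_equiv ((matCokerReindex e P).symm.restrictScalars A), ?_⟩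
  rw [modClass_congr (matCokerReindex e P), h3]

theorem matCoker_unit_class {a : A[X]} (ha : a.Monic) :
    IsFinProj A (matCoker (of fun _ _ : Unit => a)) ∧
      (modClass (matCoker (of fun _ _ : Unit => a)) : W0 A) = cyclicClass a :=
  ⟨(isFinProj_cyclic ha).of_equiv ((matCokerUnit a).symm.restrictScalars A),
    modClass_congr (matCokerUnit a)⟩

/-- One step of elimination. With `P = [D, c; b, a]`, left multiplication by `L = [a, -c; 0, 1]`
gives `U = [S, 0; b, a]`, where `S = a D - c b`. The cokernels of `L` and `U` are known by the
induction hypothesis, and `0 → coker P → coker U → coker L → 0` yields the class of `coker P`. It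
matches `det P` because `det L * det P = det U`. -/
theorem DetDeterminesClass.sum_unit {n : Type} [Fintype n] [DecidableEq n]
    (ih : DetDeterminesClass A n) : DetDeterminesClass A (n ⊕ Unit) := by
  intro d P hP
  set a : A[X] := P (Sum.inr ()) (Sum.inr ()) with ha
  set b : n → A[X] := fun j => P (Sum.inr ()) (Sum.inl j) with hb
  set c : n → A[X] := fun i => P (Sum.inl i) (Sum.inr ()) with hc
  set D : Matrix n n A[X] := of fun i j => P (Sum.inl i) (Sum.inl j) with hD
  set one1 : Matrix Unit Unit A[X] := of fun _ _ => 1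
  set a1 : Matrix Unit Unit A[X] := of fun _ _ => a
  have hPb : P = fromBlocks D (of fun i _ => c i) (of fun _ j => b j) a1 := by
    ext1 (i | i) (j | j) <;> rfl
  have ha' : a - X ^ d ∈ degreeLT A d := by simpa using hP (Sum.inr ()) (Sum.inr ())
  have ham := monic_of_sub_mem_degreeLT ha'
  have hS : IsMonicMatrix (d + d) (a • D - vecMulVec c b) := by
    refine isMonicMatrix_schur ha' (fun i => ?_) (fun i => ?_) fun i j => ?_
    · simpa using hP (Sum.inr ()) (Sum.inl i)
    · simpa using hP (Sum.inl i) (Sum.inr ())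
    · simpa [hD] using hP (Sum.inl i) (Sum.inl j)
  -- The scalar block of `L` is itself a monic matrix, so the induction hypothesis evaluates its
  -- cokernel too, with determinant `a ^ card n`.
  have hI : IsMonicMatrix d (a • (1 : Matrix n n A[X])) := fun i j => by
    rcases eq_or_ne i j with rfl | h
    · simpa using ha'
    · simp [h]
  obtain ⟨hS1, hS2, hS3⟩ := ih _ _ hS
  obtain ⟨-, hI2, hI3⟩ := ih _ _ hI
  rw [det_smul, det_one, mul_one] at hI3
  obtain ⟨ho2, ho3⟩ := matCoker_unit_class (monic_one (R := A))
  obtain ⟨hu2, hu3⟩ := matCoker_unit_class ham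
  set S := a • D - vecMulVec c b
  set L := fromBlocks (a • (1 : Matrix n n A[X])) (of fun i (_ : Unit) => -c i) 0 one1 with hL
  set U := fromBlocks S 0 (of fun _ j => b j) a1 with hU
  have hone : one1.det = 1 := by simp [one1]
  have hLP : L * P = U := by
    rw [hPb, hL, hU, fromBlocks_multiply]
    congr 1
    · ext1 i j
      simp [S, mul_apply, vecMulVec_apply, sub_eq_add_neg]
    · ext1 i j
      simp [a1, mul_apply]
      ring
    · ext1 i j
      simp [one1, mul_apply]
    · ext1 i j
      simp [one1, a1, mul_apply]
  have hLdet : L.det = a ^ Fintype.card n := by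
    rw [hL, det_fromBlocks_zero₂₁, hone, det_smul, det_one, mul_one, mul_one]
  have hdet : a ^ Fintype.card n * P.det = S.det * a := by
    rw [← hLdet, ← det_mul, hLP, hU, det_fromBlocks_zero₁₂]
    simp [a1]
  have hLm : L.det.Monic := hLdet ▸ ham.pow _
  -- A factor of a monic product is monic once the other factor is.
  have hPm : P.det.Monic := (ham.pow _).of_mul_monic_left (hdet ▸ hS1.mul ham)
  have hcomp : L.mulVecLin ∘ₗ P.mulVecLin = U.mulVecLin := by rw [← mulVecLin_mul, hLP]
  obtain ⟨hL2, hL3⟩ := matCoker_fromBlocks (b := of fun i (_ : Unit) => -c i)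
    (by rw [hone]; exact monic_one) hI2 ho2
  obtain ⟨hU2, hU3⟩ := matCoker_fromBlocks' (c := of fun _ j => b j) hS1 hS2 hu2
  have e1 := cokerCompLeft_injective hcomp (mulVecLin_injective_of_monic hLm)
  have e2 := cokerComp_exact hcomp
  have e3 := cokerCompRight_surjective hcomp
  have hP2 := IsFinProj.of_exact_left e1 e2 e3 hU2 hL2
  refine ⟨hPm, hP2, ?_⟩
  have h := modClass_exact e1 e2 e3 hP2 hL2
  rw [hU3, hL3, hI3, ho3, hS3, hu3, cyclicClass_one, ← cyclicClass_mul hS1 ham, ← hdet,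
    cyclicClass_mul (ham.pow _) hPm] at h
  linear_combination -h

theorem detDeterminesClass (n : ℕ) : DetDeterminesClass A (Fin n) := by
  induction n with
  | zero =>
    intro d P _
    have : Subsingleton (matCoker P) := (Submodule.mkQ_surjective _).subsingleton
    rw [det_isEmpty, modClass_eq_zero, cyclicClass_one]
    exact ⟨monic_one, ⟨inferInstance, inferInstance⟩, rfl⟩
  | succ n ih =>
    exact ih.sum_unit.of_equiv
      ((finSumFinEquiv (m := n) (n := 1)).symm.trans (Equiv.sumCongr (Equiv.refl _) finOneEquiv))

/-! #### The class of a pair -/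

/-- The pair `(Aⁿ, M)`. -/
noncomputable def EndObj.ofMatrix {n : ℕ} (M : Matrix (Fin n) (Fin n) A) : EndObj A where
  carrier := Fin n → A
  f := M.mulVecLin

/-- The cokernel of `X - M` is `Aⁿ` with `X` acting as `M`. -/
theorem modClass_charmatrix {n : ℕ} (M : Matrix (Fin n) (Fin n) A) :
    (modClass (matCoker M.charmatrix) : W0 A) = W0.mk (EndObj.ofMatrix M) := by
  let φ : Module.End A (Fin n → A) := M.mulVecLin
  let V := Module.AEval' φ
  let o : (Fin n → A) ≃ₗ[A] V := Module.AEval'.of φ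
  -- The `A[X]`-linear map fixing the standard basis, so that `X^k e_i` goes to `M^k e_i`; it will
  -- be inverted on the cokernel by the inclusion of constant vectors.
  let ρ : (Fin n → A[X]) →ₗ[A[X]] V :=
    (Pi.basisFun A[X] (Fin n)).constr A[X] fun i => o (Pi.single i 1)
  have hρ : ∀ i, ρ (Pi.single i 1) = o (Pi.single i 1) := fun i => by
    have := (Pi.basisFun A[X] (Fin n)).constr_basis A[X] (fun i => o (Pi.single i 1)) i
    rwa [Pi.basisFun_apply] at this
  have hmul : ∀ v : Fin n → A, M.charmatrix *ᵥ (fun i => C (v i)) =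
      (X : A[X]) • (fun i => C (v i)) - fun i => C ((M *ᵥ v) i) := fun v => by
    rw [charmatrix, sub_mulVec]
    congr 1
    · ext1 i
      simp [scalar_apply, mulVec_diagonal]
    · ext1 i
      simp [mulVec, dotProduct]
  have hsum : ∀ v : Fin n → A, ρ (fun i => C (v i)) = o v := fun v => by
    have e1 : (fun i => C (v i)) = ∑ i, C (v i) • (Pi.single i 1 : Fin n → A[X]) := by
      rw [← pi_eq_sum_univ' ]
    have e2 : v = ∑ i, v i • (Pi.single i 1 : Fin n → A) := by
      rw [← pi_eq_sum_univ']
    rw [e1, map_sum]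
    conv_rhs => rw [e2, map_sum]
    refine Finset.sum_congr rfl fun i _ => ?_
    rw [map_smul, hρ, map_smul]
    exact Module.AEval.C_smul _ _ _
  have hker : LinearMap.range M.charmatrix.mulVecLin ≤ LinearMap.ker ρ := by
    rw [LinearMap.range_le_ker_iff]
    refine LinearMap.pi_ext' fun i => LinearMap.ext_ring ?_
    have e : (LinearMap.single A[X] (fun _ : Fin n => A[X]) i) 1 =
        fun j => C ((Pi.single i 1 : Fin n → A) j) := by
      ext1 j
      rcases eq_or_ne j i with rfl | h <;> simp [*]
    rw [LinearMap.comp_apply, LinearMap.comp_apply, e, mulVecLin_apply, hmul, map_sub, map_smul,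
      hsum, hsum]
    exact sub_eq_zero.2 (Module.AEval'.X_smul_of φ _)
  let c : (Fin n → A) →ₗ[A] matCoker M.charmatrix :=
    (Submodule.mkQ (LinearMap.range M.charmatrix.mulVecLin)).restrictScalars A ∘ₗ
      LinearMap.compLeft (Algebra.linearMap A A[X]) (Fin n)
  -- Modulo the range of `X - M`, multiplying a constant vector by `X` is applying `M`. This makes
  -- the inclusion of constant vectors `A[X]`-linear on `V`.
  have hc : ∀ v, c (φ v) = (X : A[X]) • c v := fun v => by
    refine (Submodule.Quotient.eq _).2 ⟨-fun i => C (v i), ?_⟩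
    rw [map_neg, mulVecLin_apply, hmul, neg_sub]
    rfl
  let c' : V →ₗ[A[X]] matCoker M.charmatrix := LinearMap.ofAEval φ c hc
  let ρ' : matCoker M.charmatrix →ₗ[A[X]] V := Submodule.liftQ _ ρ hker
  have hc' : ∀ v, c' (o v) = Submodule.Quotient.mk fun i => C (v i) := fun v => rfl
  have h1 : ρ' ∘ₗ c' = LinearMap.id := LinearMap.ext fun x => by
    obtain ⟨v, rfl⟩ := o.surjective x
    rw [LinearMap.comp_apply, hc']
    exact hsum v
  have h2 : c' ∘ₗ ρ' = LinearMap.id := by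
    refine Submodule.linearMap_qext _ (LinearMap.pi_ext' fun i => LinearMap.ext_ring ?_)
    change c' (ρ (Pi.single i 1)) = Submodule.Quotient.mk (Pi.single i 1)
    rw [hρ, hc']
    congr 1
    ext1 j
    rcases eq_or_ne j i with rfl | h <;> simp [*]
  have : Module.Finite A V := Module.Finite.equiv o
  have : Module.Projective A V := Module.Projective.of_equiv o
  rw [modClass_congr (LinearEquiv.ofLinearMap ρ' c' h1 h2), modClass_eq]
  exact (W0.mk_eq_of_iso ⟨o, fun x => (Module.AEval'.X_smul_of φ x).symm⟩).symm

theorem isMonicMatrix_charmatrix {n : ℕ} (M : Matrix (Fin n) (Fin n) A) :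
    IsMonicMatrix 1 M.charmatrix := by
  intro i j
  have : M.charmatrix i j - (if i = j then X ^ 1 else 0) = -C (M i j) := by
    rw [charmatrix_apply, diagonal_apply, pow_one]
    ring
  rw [this, mem_degreeLT, degree_neg]
  exact degree_C_le.trans_lt (by norm_num)

theorem mk_ofMatrix {n : ℕ} (M : Matrix (Fin n) (Fin n) A) :
    W0.mk (EndObj.ofMatrix M) = cyclicClass M.charpoly := by
  rw [← modClass_charmatrix]
  exact (detDeterminesClass n 1 _ (isMonicMatrix_charmatrix M)).2.2

end MatrixCokernel

/-! ### Almkvist's theorem and the image of `L^q`. -/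

section Injectivity

open Polynomial

variable {A : Type u} [CommRing A]

/-- Modulo the pairs `(E, 0)`, every pair is equivalent to a pair `(Aⁿ, M)`. -/
theorem W0.mk_eq_of_presentation (E : EndObj A) {n : ℕ} (p : (Fin n → A) →ₗ[A] E.carrier)
    (s : E.carrier →ₗ[A] (Fin n → A)) (h : p ∘ₗ s = .id) :
    W0.mk E = W0.mk (EndObj.ofMatrix (LinearMap.toMatrix' (s ∘ₗ E.f ∘ₗ p))) := by
  have hps : ∀ x, p (s x) = x := LinearMap.congr_fun h
  let r : (Fin n → A) →ₗ[A] LinearMap.ker p :=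
    (LinearMap.id - s ∘ₗ p).codRestrict _ fun x => by
      simp [LinearMap.mem_ker, hps]
  have hr : ∀ x, (r x : Fin n → A) = x - s (p x) := fun x => rfl
  have hrs : r ∘ₗ (LinearMap.ker p).subtype = .id := LinearMap.ext fun x => Subtype.ext <| by
    rw [LinearMap.comp_apply, hr, Submodule.subtype_apply, LinearMap.mem_ker.1 x.2]
    simp
  have hsurj : Function.Surjective r := fun x => ⟨x, LinearMap.congr_fun hrs x⟩
  have : Module.Finite A (LinearMap.ker p) := Module.Finite.of_surjective r hsurj
  have : Module.Projective A (LinearMap.ker p) := Module.Projective.of_split _ r hrs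
  -- The endomorphism `s f p` has its image inside the range of `s`, which is the kernel of `r`;
  -- hence it induces zero on the quotient `ker p` of `Aⁿ`.
  let K : EndObj A := { carrier := LinearMap.ker p, f := 0 }
  have hrs0 : ∀ x, r (s x) = 0 := fun x => Subtype.ext <| by
    rw [hr, hps, sub_self, ZeroMemClass.coe_zero]
  have hex : Function.Exact s r := by
    refine fun y => ⟨fun e => ⟨p y, ?_⟩, ?_⟩
    · have := congrArg Subtype.val e
      rw [hr, ZeroMemClass.coe_zero, sub_eq_zero] at this
      exact this.symm
    · rintro ⟨x, rfl⟩
      exact hrs0 x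
  have hf : ∀ x, (EndObj.ofMatrix (LinearMap.toMatrix' (s ∘ₗ E.f ∘ₗ p))).f x =
      s (E.f (p x)) := fun x => LinearMap.toMatrix'_mulVec _ x
  have hsf : ∀ x, s (E.f x) = s (E.f (p (s x))) := fun x => by rw [hps]
  have hex : EndObj.ShortExact E (EndObj.ofMatrix (LinearMap.toMatrix' (s ∘ₗ E.f ∘ₗ p))) K :=
    ⟨s, r, Function.LeftInverse.injective hps, hex, hsurj, fun x => (hsf x).trans (hf (s x)).symm,
      fun x => (congrArg r (hf x)).trans (hrs0 _)⟩
  rw [W0.mk_shortExact hex, W0.mk_eq_zero (E := K) rfl, add_zero]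

/-- Multiplication by `X^k` does not change the reversed coefficients if the degree of reflection
grows by `k`. Both products therefore have the same reflection in degree `deg p + deg r`, and
reflection is an involution. -/
theorem mul_X_pow_eq_of_reverse_eq {p r : A[X]} (h : p.reverse = r.reverse) :
    p * X ^ r.natDegree = r * X ^ p.natDegree := by
  have key : ∀ (p : A[X]) (k : ℕ), reflect (p.natDegree + k) (p * X ^ k) = p.reverse := by
    intro p k
    rw [reflect_mul _ _ le_rfl (natDegree_X_pow_le k), reverse]
    simp [reflect_monomial]
  have e := congrArg (reflect (p.natDegree + r.natDegree)) ((key p r.natDegree).trans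
    (h.trans (key r p.natDegree).symm))
  rw [add_comm r.natDegree] at e
  rwa [reflect_reflect, reflect_reflect] at e

/-- The determinants are reversed characteristic polynomials, so the latter agree up to powers of
`X`, and `cyclicClass` does not see these. -/
theorem W0.mk_eq_of_charDet_eq {E F : EndObj A} (h : E.charDet = F.charDet) :
    W0.mk E = W0.mk F := by
  obtain ⟨n, p, s, hps⟩ := E.exists_presentation
  obtain ⟨n', p', s', hps'⟩ := F.exists_presentation
  rw [E.charDet_eq p s hps, F.charDet_eq p' s' hps', ← Matrix.reverse_charpoly,
    ← Matrix.reverse_charpoly] at h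
  rw [W0.mk_eq_of_presentation E p s hps, W0.mk_eq_of_presentation F p' s' hps', mk_ofMatrix,
    mk_ofMatrix]
  have e := congrArg cyclicClass (mul_X_pow_eq_of_reverse_eq h)
  rwa [cyclicClass_mul (Matrix.charpoly_monic _) (monic_X_pow _), cyclicClass_X_pow, add_zero,
    cyclicClass_mul (Matrix.charpoly_monic _) (monic_X_pow _), cyclicClass_X_pow, add_zero] at e

/-- The direct sum of two pairs. -/
def EndObj.prod (E F : EndObj A) : EndObj A where
  carrier := E.carrier × F.carrier
  f := E.f.prodMap F.f

theorem W0.mk_prod (E F : EndObj A) : W0.mk (E.prod F) = W0.mk E + W0.mk F :=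
  W0.mk_shortExact ⟨LinearMap.inl A _ _, LinearMap.snd A _ _, LinearMap.inl_injective,
    Function.Exact.inl_snd, LinearMap.snd_surjective,
    fun _ => Prod.ext rfl (map_zero F.f).symm, fun _ => rfl⟩

/-- Every element of `W₀(A)` is a difference of classes of pairs. -/
theorem W0.exists_eq_sub (w : W0 A) : ∃ E F : EndObj A, w = W0.mk E - W0.mk F := by
  obtain ⟨w, rfl⟩ := Ideal.Quotient.mk_surjective w
  obtain ⟨w, rfl⟩ := Ideal.Quotient.mk_surjective w
  induction w using FreeAbelianGroup.induction_on with
  | zero => exact ⟨EndObj.unit A, EndObj.unit A, by simp⟩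
  | of x =>
    obtain ⟨E, rfl⟩ := Quotient.exists_rep x
    -- Any pair can be added and subtracted here; `(A, id)` is at hand.
    exact ⟨E.prod (EndObj.unit A), EndObj.unit A, by rw [W0.mk_prod, add_sub_cancel_right]; rfl⟩
  | neg x h =>
    obtain ⟨E, F, h⟩ := h
    exact ⟨F, E, by rw [map_neg, map_neg, h, neg_sub]⟩
  | add x y hx hy =>
    obtain ⟨E, F, hx⟩ := hx
    obtain ⟨E', F', hy⟩ := hy
    refine ⟨E.prod E', F.prod F', ?_⟩
    rw [map_add, map_add, hx, hy, W0.mk_prod, W0.mk_prod]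
    abel

variable {q : ℕ} [NeZero q] [Invertible (q : A)]

theorem LambdaQ.ofW0_injective : Function.Injective (ofW0 (A := A) q) := by
  refine (injective_iff_map_eq_zero _).2 fun w hw => ?_
  obtain ⟨E, F, rfl⟩ := W0.exists_eq_sub w
  rw [map_sub, sub_eq_zero, ofW0_mk, ofW0_mk] at hw
  have hE := ofEndObj_val_mul (q := q) E
  have hF := ofEndObj_val_mul (q := q) F
  rw [hw] at hE
  have e : (E.charDet : A⟦X⟧) ^ q = (F.charDet : A⟦X⟧) ^ q := by
    linear_combination (F.charDet : A⟦X⟧) ^ q * hE - (E.charDet : A⟦X⟧) ^ q * hF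
  have := Polynomial.coe_injective A (eq_of_pow_eq_pow E.const_charDet F.const_charDet e)
  rw [W0.mk_eq_of_charDet_eq this, sub_self]

/-- Every polynomial with constant term `1` is the characteristic determinant of a pair. -/
theorem EndObj.exists_charDet_eq {P : A[X]} (hP : P.coeff 0 = 1) :
    ∃ E : EndObj A, E.charDet = P := by
  -- The reverse of `P` has leading coefficient `P.coeff 0 = 1` only because this is nonzero, so the
  -- zero ring is set apart.
  rcases subsingleton_or_nontrivial A with _ | _
  · exact ⟨EndObj.unit A, Subsingleton.elim _ _⟩
  have h0 : P.coeff 0 ≠ 0 := by rw [hP]; exact one_ne_zero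
  have hg : P.reverse.Monic := by
    rw [Monic, reverse_leadingCoeff, trailingCoeff, natTrailingDegree_eq_zero.2 (Or.inr h0), hP]
  set g := P.reverse with hgdef
  have := hg.finite_adjoinRoot
  have := hg.free_adjoinRoot
  let B := AdjoinRoot.powerBasis' hg
  -- The companion pair of `g`: multiplication by the root on `A[X]/(g)`.
  let E : EndObj A := { carrier := AdjoinRoot g, f := Algebra.lmul A _ (AdjoinRoot.root g) }
  refine ⟨E, ?_⟩
  let M := Algebra.leftMulMatrix B.basis (AdjoinRoot.root g)
  have hM : E.charDet = M.charpolyRev := E.charDet_eq_of_basis B.basis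
  have hchar : M.charpoly = g := by
    -- By Cayley–Hamilton the root is annihilated by the characteristic polynomial, which is then
    -- divisible by `g`; both are monic of the same degree.
    have h1 : aeval (AdjoinRoot.root g) M.charpoly = 0 := by
      apply Algebra.leftMulMatrix_injective B.basis
      rw [map_zero, ← aeval_algHom_apply]
      exact Matrix.aeval_self_charpoly M
    have h2 : g ∣ M.charpoly := by
      rwa [AdjoinRoot.aeval_eq, AdjoinRoot.mk_eq_zero] at h1
    refine eq_of_monic_of_dvd_of_natDegree_le hg (Matrix.charpoly_monic M) h2 ?_
    rw [Matrix.charpoly_natDegree_eq_dim, Fintype.card_fin]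
    exact (AdjoinRoot.powerBasis'_dim hg).le
  rw [hM, ← Matrix.reverse_charpoly, hchar]
  -- Reversing preserves the degree because the constant term is nonzero, so reversing twice returns
  -- `P`.
  have hdeg : g.natDegree = P.natDegree := by
    rw [hgdef, reverse_natDegree, natTrailingDegree_eq_zero.2 (Or.inr h0), Nat.sub_zero]
  rw [reverse, hdeg, hgdef, reverse, reflect_reflect]

theorem LambdaQ.range_ofW0 : Set.range (fun w : W0 A => (ofW0 q w).val) =
    {f : A⟦X⟧ | ∃ P Q : A[X], P.coeff 0 = 1 ∧ Q.coeff 0 = 1 ∧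
      f * (Q : A⟦X⟧) ^ q = (P : A⟦X⟧) ^ q} := by
  have hc : ∀ E : EndObj A, E.charDet.coeff 0 = 1 := fun E => by
    rw [← Polynomial.constantCoeff_coe, E.const_charDet]
  -- The exponent `-q` exchanges numerator and denominator: `[E] - [F]` maps to `det(F)^q /
  -- det(E)^q`.
  have hval : ∀ E F : EndObj A, (ofW0 q (W0.mk E - W0.mk F)).val * (E.charDet : A⟦X⟧) ^ q =
      (F.charDet : A⟦X⟧) ^ q := fun E F => by
    have h : ofW0 q (W0.mk E - W0.mk F) + ofEndObj q F = ofEndObj q E := by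
      rw [map_sub, ofW0_mk, ofW0_mk, sub_add_cancel]
    have h' := congrArg LambdaQ.val h
    rw [val_add] at h'
    have hE := ofEndObj_val_mul (q := q) E
    have hF := ofEndObj_val_mul (q := q) F
    rw [← h'] at hE
    linear_combination (F.charDet : A⟦X⟧) ^ q * hE -
      (ofW0 q (W0.mk E - W0.mk F)).val * (E.charDet : A⟦X⟧) ^ q * hF
  ext f
  constructor
  · rintro ⟨w, rfl⟩
    obtain ⟨E, F, rfl⟩ := W0.exists_eq_sub w
    exact ⟨F.charDet, E.charDet, hc F, hc E, hval E F⟩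
  · rintro ⟨P, Q, hP, hQ, h⟩
    obtain ⟨E, rfl⟩ := EndObj.exists_charDet_eq hQ
    obtain ⟨F, rfl⟩ := EndObj.exists_charDet_eq hP
    refine ⟨W0.mk E - W0.mk F, ?_⟩
    have hE := ofEndObj_val_mul (q := q) E
    linear_combination (ofEndObj q E).val * (hval E F - h) +
      (f - (ofW0 q (W0.mk E - W0.mk F)).val) * hE

end Injectivity

end WittQ

/-! ### The main theorem. -/

theorem mainTheorem4 {A : Type u} [CommRing A] (q : ℕ) [NeZero q] [Invertible (q : A)] :
    ∃ L : WittQ.W0 A →+* WittQ.LambdaQ q A,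
      (∀ E : WittQ.EndObj A, (L (WittQ.W0.mk E)).val * (E.charDet : A⟦X⟧) ^ q = 1) ∧
      Function.Injective L ∧
      Set.range (fun w => (L w).val) =
        {f : A⟦X⟧ | ∃ P Q : A[X], P.coeff 0 = 1 ∧ Q.coeff 0 = 1 ∧
          f * (Q : A⟦X⟧) ^ q = (P : A⟦X⟧) ^ q} ∧
      ∃ φ : WittQ.W0 A →ₙ+* WittQ.QWitt q A,
        Function.Injective φ ∧ (∀ x, φ 1 * x = x) ∧ ∀ w, WittQ.artinHasse (φ w) = L w := by
  let e := WittQ.artinHasseEquiv q A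
  let L := WittQ.LambdaQ.ofW0 (A := A) q
  refine ⟨L, fun E => ?_, WittQ.LambdaQ.ofW0_injective, WittQ.LambdaQ.range_ofW0,
    (e.symm : WittQ.LambdaQ q A →ₙ+* WittQ.QWitt q A).comp (L : WittQ.W0 A →ₙ+* _),
    e.symm.injective.comp WittQ.LambdaQ.ofW0_injective, fun x => ?_, fun w => ?_⟩
  · rw [WittQ.LambdaQ.ofW0_mk]
    exact WittQ.LambdaQ.ofEndObj_val_mul E
  -- The Artin–Hasse image of `φ 1` is `L 1 = 1`, so `φ 1` is an identity of `W^q(A)` although that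
  -- ring carries only a non-unital structure.
  · apply e.injective
    change e (e.symm (L 1) * x) = e x
    rw [map_mul, e.apply_symm_apply, map_one, one_mul]
  · exact e.apply_symm_apply (L w)
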